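/- Let $1\le m<n$ be integers and let $F\subseteq\mathbb R^n$ be non-empty. For a non-empty bounded set $E\subseteq\mathbb R^n$ let $N_r(E)$ be the least number of sets of diameter at most $r$ that cover $E$, and let $$\underline{\dim}_{\mathrm B}E=\liminf_{r\to0}\frac{\log N_r(E)}{-\log r},\qquad \overline{\dim}_{\mathrm B}E=\limsup_{r\to0}\frac{\log N_r(E)}{-\log r}$$ be its lower and upper box dimensions. The packing dimension of a (not necessarily bounded) set $E$ is $$\dim_{\mathrm P}E=\inf\Big\{\sup_j\overline{\dim}_{\mathrm B}E_j : E\subseteq\bigcup_{j=1}^\infty E_j,\ E_j\text{ compact}\Big\}.$$ For $\theta\in(0,1)$, the upper Assouad spectrum $\overline{\dim}{}_{\mathrm A}^{\theta}F$ is the infimum of all $\alpha$ for which there is $C>0$ with $N_r(B(x,R)\cap F)\le C(R/r)^\alpha$ for all $x\in F$ and all $0<r\le R^{1/\theta}<R<1$, where $B(x,R)$ is the closed ball of centre $x$ and radius $R$. The quasi-Assouad dimension is $\dim_{\mathrm{qA}}F=\lim_{\theta\nearrow1}\overline{\dim}{}_{\mathrm A}^{\theta}F$. Let $G(n,m)$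 be the Grassmannian of $m$-dimensional linear subspaces of $\mathbb R^n$; "almost all $V\in G(n,m)$" refers to its rotation-invariant Borel probability measure, and $\pi_V$ is the orthogonal projection onto $V$. (1) Suppose that $F$ is bounded and let $\dim$ be either one of $\overline{\dim}_{\mathrm B}$ and $\underline{\dim}_{\mathrm B}$. Then, for almost all $V\in G(n,m)$, $$\dim\pi_VF\ \ge\ \dim F-\max\{0,\ \dim_{\mathrm{qA}}F-m\}.$$ If moreover $\dim_{\mathrm{qA}}F\le\max\{m,\dim F\}$, then, for almost all $V\in G(n,m)$, $$\dim\pi_VF=\min\{m,\dim F\}.$$ (2) Suppose that $F$ is a Borel set, bounded or not. Then both conclusions of (1) hold with $\dim=\dim_{\mathrm P}$: for almost all $V\in G(n,m)$ one has $\dim_{\mathrm P}\pi_VF\ge\dim_{\mathrm P}F-\max\{0,\dim_{\mathrm{qA}}F-m\}$, and if $\dim_{\mathrm{qA}}F\le\max\{m,\dim_{\mathrm P}F\}$, then, for almost all $V\in G(n,m)$, $\dim_{\mathrm P}\pi_VF=\min\{m,\dim_{\mathrm P}F\}$. -/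

import Mathlib

open Set Filter Topology MeasureTheory
open scoped ENNReal

noncomputable section

namespace ProjDim

/-! ### Covering numbers, box dimensions and packing dimension -/

/-- `N_r(F)`: the least number of sets of diameter at most `r` that cover `F`
(`⊤` if no finite family does). -/
def coverNum {X : Type*} [PseudoEMetricSpace X] (r : ℝ) (F : Set X) : ℕ∞ :=
  ⨅ (C : Finset (Set X)) (_ : F ⊆ ⋃ U ∈ C, U)
    (_ : ∀ U ∈ C, Metric.ediam U ≤ ENNReal.ofReal r), (C.card : ℕ∞)

/-- The ratio `log N_r(F) / (- log r)`. -/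
def boxRatio {X : Type*} [PseudoEMetricSpace X] (F : Set X) (r : ℝ) : EReal :=
  ENNReal.log (coverNum r F : ℝ≥0∞) / ((-Real.log r : ℝ) : EReal)

/-- Lower box dimension. -/
def lowerBoxDim {X : Type*} [PseudoEMetricSpace X] (F : Set X) : EReal :=
  liminf (boxRatio F) (𝓝[>] (0 : ℝ))

/-- Upper box dimension. -/
def upperBoxDim {X : Type*} [PseudoEMetricSpace X] (F : Set X) : EReal :=
  limsup (boxRatio F) (𝓝[>] (0 : ℝ))

/-- Packing dimension: the infimum of `sup_j (upper box dimension of K_j)` over countable covers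
of `F` by compact sets `K_j`. -/
def packingDim {X : Type*} [PseudoEMetricSpace X] (F : Set X) : EReal :=
  ⨅ (K : ℕ → Set X) (_ : ∀ j, IsCompact (K j)) (_ : F ⊆ ⋃ j, K j), ⨆ j, upperBoxDim (K j)

/-! ### Upper Assouad spectrum and quasi-Assouad dimension -/

/-- The exponents admitted in the definition of the upper Assouad spectrum at `θ`. -/
def IsSpectrumExponent {X : Type*} [PseudoMetricSpace X] (θ : ℝ) (F : Set X) (α : ℝ) : Prop :=
  ∃ C : ℝ, 0 < C ∧ ∀ r R : ℝ, 0 < r → r ≤ R ^ (1 / θ) → R ^ (1 / θ) < R → R < 1 →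
    ∀ x ∈ F, (coverNum r (Metric.closedBall x R ∩ F) : ℝ≥0∞) ≤ ENNReal.ofReal (C * (R / r) ^ α)

/-- The upper Assouad spectrum at `θ ∈ (0,1)`. -/
def upperAssouadSpectrum {X : Type*} [PseudoMetricSpace X] (θ : ℝ) (F : Set X) : EReal :=
  ⨅ (α : ℝ) (_ : IsSpectrumExponent θ F α), (α : EReal)

/-- The quasi-Assouad dimension: the limit of the upper Assouad spectrum as `θ` increases to `1`.
It is written as an upper limit; `tendsto_quasiAssouadDim` shows that it is a limit. -/
def quasiAssouadDim {X : Type*} [PseudoMetricSpace X] (F : Set X) : EReal :=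
  limsup (fun θ : ℝ => upperAssouadSpectrum θ F) (𝓝[<] (1 : ℝ))

theorem upperAssouadSpectrum_mono {X : Type*} [PseudoMetricSpace X] (F : Set X) {θ θ' : ℝ}
    (h0 : 0 < θ) (h : θ ≤ θ') (h1 : θ' < 1) :
    upperAssouadSpectrum θ F ≤ upperAssouadSpectrum θ' F := by
  refine le_iInf₂ fun α hα => iInf₂_le α ?_
  obtain ⟨C, hC, H⟩ := hα
  refine ⟨C, hC, fun r R hr hrR hRR hR1 x hx => ?_⟩
  have h0' : 0 < θ' := h0.trans_le h
  have hR0 : 0 < R := (hr.trans_le hrR).trans hRR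
  have hinv : 1 / θ' ≤ 1 / θ := one_div_le_one_div_of_le h0 h
  refine H r R hr (hrR.trans (Real.rpow_le_rpow_of_exponent_ge hR0 hR1.le hinv)) ?_ hR1 x hx
  calc R ^ (1 / θ') < R ^ (1 : ℝ) :=
        Real.rpow_lt_rpow_of_exponent_gt hR0 hR1 ((one_lt_div h0').2 h1)
    _ = R := Real.rpow_one R

theorem tendsto_quasiAssouadDim {X : Type*} [PseudoMetricSpace X] (F : Set X) :
    Tendsto (fun θ : ℝ => upperAssouadSpectrum θ F) (𝓝[<] (1 : ℝ)) (𝓝 (quasiAssouadDim F)) := by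
  have h01 : (0 : ℝ) < 1 := one_pos
  have hmono : MonotoneOn (fun θ : ℝ => upperAssouadSpectrum θ F) (Ioo 0 1) :=
    fun a ha b hb hab => upperAssouadSpectrum_mono F ha.1 hab hb.2
  have key := hmono.tendsto_nhdsWithin_Ioo_left (nonempty_Ioo.2 h01) (OrderTop.bddAbove _)
  have : quasiAssouadDim F = sSup ((fun θ : ℝ => upperAssouadSpectrum θ F) '' Ioo 0 1) :=
    key.limsup_eq
  rw [this]
  exact key

/-! ### The Grassmannian and its invariant measure -/

/-- Euclidean space `ℝⁿ`. -/
abbrev E (n : ℕ) : Type := EuclideanSpace ℝ (Fin n)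

/-- The orthogonal group `O(n)`, as a subgroup of the linear operators on `ℝⁿ` with the topology
of the operator norm. -/
abbrev O (n : ℕ) : Type := unitary (E n →L[ℝ] E n)

instance instContinuousStarO (n : ℕ) : ContinuousStar (E n →L[ℝ] E n) :=
  ⟨(ContinuousLinearMap.adjoint (𝕜 := ℝ) (E := E n) (F := E n)).continuous⟩

instance instCompactSpaceO (n : ℕ) : CompactSpace (O n) := by
  have : ProperSpace (E n →L[ℝ] E n) := FiniteDimensional.proper ℝ _
  refine isCompact_iff_compactSpace.1
    (Metric.isCompact_of_isClosed_isBounded (isClosed_unitary (R := E n →L[ℝ] E n)) ?_)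
  refine (Metric.isBounded_closedBall (x := (0 : E n →L[ℝ] E n)) (r := 1)).subset fun u hu => ?_
  rw [mem_closedBall_zero_iff]
  refine ContinuousLinearMap.opNorm_le_bound _ zero_le_one fun x => ?_
  rw [one_mul]
  exact (Unitary.norm_map (⟨u, hu⟩ : O n) x).le

/-- The Grassmannian `G(n,m)` of `m`-dimensional linear subspaces of `ℝⁿ`. -/
def Gr (n m : ℕ) : Type := {V : Submodule ℝ (E n) // Module.finrank ℝ V = m}

/-- The usual topology of `G(n,m)`, given by the metric `‖π_V - π_W‖`. -/
instance instTopologicalSpaceGr (n m : ℕ) : TopologicalSpace (Gr n m) :=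
  TopologicalSpace.induced (fun V => V.1.starProjection) inferInstance

/-- The Borel sets of `G(n,m)`. -/
instance instMeasurableSpaceGr (n m : ℕ) : MeasurableSpace (Gr n m) := borel _

instance instBorelSpaceGr (n m : ℕ) : BorelSpace (Gr n m) := ⟨rfl⟩

/-- The action of `O(n)` on `G(n,m)`: `(g, V) ↦ g V`. -/
def rotate {n m : ℕ} (g : O n) (V : Gr n m) : Gr n m :=
  ⟨V.1.map (Unitary.linearIsometryEquiv g).toLinearEquiv.toLinearMap, by
    rw [LinearEquiv.finrank_map_eq]; exact V.2⟩

/-- The subspace of `ℝⁿ` spanned by the first `m` coordinate vectors. -/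
def coordSubspace {n m : ℕ} (h : m ≤ n) : Gr n m :=
  ⟨Submodule.span ℝ (range fun i : Fin m =>
      (EuclideanSpace.single (Fin.castLE h i) (1 : ℝ) : E n)), by
    have hli : LinearIndependent ℝ (fun i : Fin m =>
        (EuclideanSpace.single (Fin.castLE h i) (1 : ℝ) : E n)) :=
      ((EuclideanSpace.orthonormal_single (𝕜 := ℝ) (ι := Fin n)).comp _
        (Fin.castLE_injective h)).linearIndependent
    rw [finrank_span_eq_card hli, Fintype.card_fin]⟩

/-- The natural invariant probability measure on `G(n,m)`: the image of the normalized Haar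
measure of `O(n)` under `g ↦ g V₀`, where `V₀` is spanned by the first `m` coordinate vectors. -/
def grMeasure {n m : ℕ} (h : m ≤ n) : Measure (Gr n m) :=
  (Measure.haarMeasure (⊤ : TopologicalSpace.PositiveCompacts (O n))).map
    fun g => rotate g (coordSubspace h)

theorem starProjection_rotate {n m : ℕ} (g : O n) (V : Gr n m) :
    (rotate g V).1.starProjection =
      (g : E n →L[ℝ] E n) * V.1.starProjection * star (g : E n →L[ℝ] E n) := by
  ext1 x
  exact Submodule.starProjection_map_apply (Unitary.linearIsometryEquiv g) V.1 x

theorem continuous_rotate_left {n m : ℕ} (V : Gr n m) : Continuous fun g : O n => rotate g V := by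
  refine continuous_induced_rng.2 ?_
  have : ((fun V : Gr n m => V.1.starProjection) ∘ fun g : O n => rotate g V) = fun g : O n =>
      (g : E n →L[ℝ] E n) * V.1.starProjection * star (g : E n →L[ℝ] E n) :=
    funext fun g => starProjection_rotate g V
  rw [this]
  fun_prop

theorem continuous_rotate_right {n m : ℕ} (g : O n) :
    Continuous fun V : Gr n m => rotate g V := by
  refine continuous_induced_rng.2 ?_
  have : ((fun V : Gr n m => V.1.starProjection) ∘ fun V : Gr n m => rotate g V) =
      fun V : Gr n m =>
        (g : E n →L[ℝ] E n) * V.1.starProjection * star (g : E n →L[ℝ] E n) :=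
    funext fun V => starProjection_rotate g V
  rw [this]
  have h : Continuous fun V : Gr n m => V.1.starProjection := continuous_induced_dom
  exact (continuous_const.mul h).mul continuous_const

/-- `grMeasure` is a probability measure. -/
instance instIsProbabilityMeasureGr {n m : ℕ} (h : m ≤ n) :
    IsProbabilityMeasure (grMeasure h) := by
  have : IsProbabilityMeasure
      (Measure.haarMeasure (⊤ : TopologicalSpace.PositiveCompacts (O n))) :=
    ⟨by simpa using
      Measure.haarMeasure_self (K₀ := (⊤ : TopologicalSpace.PositiveCompacts (O n)))⟩
  exact Measure.isProbabilityMeasure_map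
    (continuous_rotate_left (coordSubspace h)).measurable.aemeasurable

/-- `grMeasure` is invariant under the action of `O(n)`. -/
theorem map_rotate_grMeasure {n m : ℕ} (h : m ≤ n) (g : O n) :
    (grMeasure h).map (rotate g) = grMeasure h := by
  have hl := (continuous_rotate_left (n := n) (coordSubspace h)).measurable
  have hmul : ∀ k : O n,
      rotate g (rotate k (coordSubspace h)) = rotate (g * k) (coordSubspace h) := by
    intro k
    refine Subtype.ext ?_
    simp only [rotate, ← Submodule.map_comp]
    rfl
  unfold grMeasure
  rw [Measure.map_map (continuous_rotate_right g).measurable hl]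
  conv_rhs => rw [← map_mul_left_eq_self
    (Measure.haarMeasure (⊤ : TopologicalSpace.PositiveCompacts (O n))) g]
  rw [Measure.map_map hl (measurable_const_mul g)]
  congr 1
  funext k
  exact hmul k

/-- `π_V F`, the image of `F` under orthogonal projection onto `V`, as a subset of `ℝⁿ`. -/
def proj {n m : ℕ} (V : Gr n m) (F : Set (E n)) : Set (E n) := V.1.starProjection '' F

end ProjDim

end

noncomputable section

namespace ProjDim

/-! ### Covering numbers and separated sets -/

/-! The box dimension bound is a second moment argument, run scale by scale. Let δ = 2^{-k} and let
P be a maximal δ/4-separated subset of the bounded set F. Distributing P among the sets of an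
optimal δ-cover of π_V F and applying Cauchy–Schwarz gives |P|² ≤ N_δ(π_V F) · #{(x, y) ∈ P² : |π_V
x - π_V y| ≤ δ} (`sq_card_le_coverNum_mul`).

The expected number of such pairs is controlled by two facts. A vector z is projected to length at
most δ with probability O((δ/|z|)^m) (`exists_grMeasure_norm_starProjection_le`). If α is an
exponent for the spectrum at θ, a ball of radius R ≥ δ/4 centred in F contains O(δ^{-(1-θ)α}
(R/δ)^α) points of P (`exists_card_le_of_isSpectrumExponent`). Summing over dyadic distances, the
expectation is at most |P| times O(k δ^{-((1-θ)α + max(0, α-m))}) (`exists_sum_grMeasure_le`).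
Markov and Borel–Cantelli then give, for almost every V, N_r(F) ≤ N_r(π_V F) r^{-η} for all small r,
whenever η exceeds that exponent. Letting θ → 1 makes every η > max(0, dim_qA F - m) admissible, and
rational η suffice.

For packing dimension, a Borel set is a continuous image of a Polish space. Removing the basic open
sets with images of packing dimension at most t < dim_P F leaves a nonempty Polish space whose
nonempty open sets all have images of packing dimension above t. The box bound holds for almost
every V on all bounded images of basic open sets at once. Baire's theorem places the projection of
one such image inside a single member of any compact cover of π_V F (`ae_packingDim_proj_ge_of_lt`).

The equalities add the upper bounds min(m, dim F): projections are 1-Lipschitz with values in an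
m-dimensional space. -/

theorem coverNum_le_card {X : Type*} [PseudoEMetricSpace X] {r : ℝ} {A : Set X}
    (C : Finset (Set X)) (hA : A ⊆ ⋃ U ∈ C, U)
    (hC : ∀ U ∈ C, Metric.ediam U ≤ ENNReal.ofReal r) : coverNum r A ≤ C.card :=
  iInf_le_of_le C (iInf₂_le_of_le hA hC le_rfl)

theorem coverNum_mono {X : Type*} [PseudoEMetricSpace X] {r : ℝ} {A B : Set X} (h : A ⊆ B) :
    coverNum r A ≤ coverNum r B :=
  le_iInf fun C => le_iInf₂ fun hB hC => coverNum_le_card C (h.trans hB) hC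

theorem coverNum_anti {X : Type*} [PseudoEMetricSpace X] {r s : ℝ} (h : r ≤ s) (A : Set X) :
    coverNum s A ≤ coverNum r A :=
  le_iInf fun C => le_iInf₂ fun hA hC =>
    coverNum_le_card C hA fun U hU => (hC U hU).trans (ENNReal.ofReal_le_ofReal h)

theorem coverNum_image_le {X Y : Type*} [PseudoEMetricSpace X] [PseudoEMetricSpace Y] {f : X → Y}
    (hf : LipschitzWith 1 f) (r : ℝ) (A : Set X) : coverNum r (f '' A) ≤ coverNum r A := by
  classical
  refine le_iInf fun C => le_iInf₂ fun hA hC => ?_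
  refine (coverNum_le_card (C.image (image f)) ?_ ?_).trans (by exact_mod_cast Finset.card_image_le)
  · rintro _ ⟨x, hx, rfl⟩
    obtain ⟨U, hU, hxU⟩ := mem_iUnion₂.1 (hA hx)
    exact mem_iUnion₂.2 ⟨f '' U, Finset.mem_image_of_mem _ hU, mem_image_of_mem f hxU⟩
  · intro U hU
    obtain ⟨W, hW, rfl⟩ := Finset.mem_image.1 hU
    refine (hf.ediam_image_le W).trans ?_
    simpa using hC W hW

/-- A set of diameter at most r contains at most one point of an r-separated set. -/
theorem card_le_coverNum {X : Type*} [PseudoMetricSpace X] {r : ℝ} (hr : 0 ≤ r) {A : Set X}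
    {P : Finset X} (hPA : ↑P ⊆ A) (hP : (P : Set X).Pairwise fun x y => r < dist x y) :
    (P.card : ℕ∞) ≤ coverNum r A := by
  classical
  refine le_iInf fun C => le_iInf₂ fun hA hC => ?_
  have h : ∀ x ∈ P, ∃ U ∈ C, x ∈ U := fun x hx => by
    simpa using hA (hPA hx)
  choose! f hfC hf using h
  have : P.card ≤ C.card := by
    refine Finset.card_le_card_of_injOn f hfC fun x hx y hy hxy => ?_
    by_contra hne
    have h1 : edist x y ≤ ENNReal.ofReal r :=
      (Metric.edist_le_ediam_of_mem (hf x hx) (hxy ▸ hf y hy)).trans (hC _ (hfC x hx))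
    rw [edist_dist, ENNReal.ofReal_le_ofReal_iff hr] at h1
    exact absurd (hP hx hy hne) (not_lt.2 h1)
  exact_mod_cast this

theorem exists_maximal_separated {X : Type*} [PseudoMetricSpace X] {A : Set X}
    (hA : TotallyBounded A) {ρ : ℝ} (hρ : 0 < ρ) :
    ∃ P : Finset X, ↑P ⊆ A ∧ ((P : Set X).Pairwise fun x y => ρ < dist x y) ∧
      ∀ x ∈ A, ∃ y ∈ P, dist x y ≤ ρ := by
  lift ρ to NNReal using hρ.le
  have hρ' : (0 : NNReal) < ρ := by exact_mod_cast hρ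
  have hfin : Metric.packingNumber ρ A ≠ ⊤ := by
    obtain ⟨N, -, hN, hc⟩ := Metric.exists_finite_isCover_of_totallyBounded
      (ε := ρ / 2) (half_pos hρ').ne' hA
    have h := (Metric.packingNumber_two_mul_le_externalCoveringNumber (ρ / 2) A).trans
      hc.externalCoveringNumber_le_encard
    rw [mul_div_cancel₀ _ (two_ne_zero)] at h
    exact (h.trans_lt hN.encard_lt_top).ne
  have hF : (Metric.maximalSeparatedSet ρ A).Finite := by
    rw [← Set.encard_ne_top_iff, Metric.encard_maximalSeparatedSet hfin]
    exact hfin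
  refine ⟨hF.toFinset, by simpa using Metric.maximalSeparatedSet_subset, ?_, fun x hx => ?_⟩
  · intro x hx y hy hxy
    have := Metric.isSeparated_maximalSeparatedSet (ε := ρ) (A := A)
      (by simpa using hx) (by simpa using hy) hxy
    have h : (ρ : ℝ≥0∞) < edist x y := this
    rw [edist_nndist] at h
    exact_mod_cast h
  · obtain ⟨y, hy, hxy⟩ := Metric.isCover_maximalSeparatedSet hfin hx
    refine ⟨y, by simpa using hy, ?_⟩
    have hxy : edist x y ≤ ρ := hxy
    rw [edist_nndist] at hxy
    exact_mod_cast hxy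

theorem coverNum_two_mul_le_card {X : Type*} [PseudoMetricSpace X] {A : Set X} {P : Finset X}
    {ρ : ℝ} (h : ∀ x ∈ A, ∃ y ∈ P, dist x y ≤ ρ) : coverNum (2 * ρ) A ≤ P.card := by
  classical
  refine (coverNum_le_card (P.image fun y => Metric.closedBall y ρ) ?_ ?_).trans
    (by exact_mod_cast Finset.card_image_le)
  · intro x hx
    obtain ⟨y, hy, hxy⟩ := h x hx
    exact mem_iUnion₂.2 ⟨_, Finset.mem_image_of_mem _ hy, hxy⟩
  · intro U hU
    obtain ⟨y, -, rfl⟩ := Finset.mem_image.1 hU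
    refine Metric.ediam_le fun x hx z hz => ?_
    rw [edist_dist]
    have := dist_triangle_right x z y
    exact ENNReal.ofReal_le_ofReal
      (by linarith [Metric.mem_closedBall.1 hx, Metric.mem_closedBall.1 hz])

/-! ### Comparison of box dimensions -/

/-- After taking logarithms and dividing by -log r, a factor r^{-η} is an additive η. -/
theorem boxRatio_le_add {X Y : Type*} [PseudoEMetricSpace X] [PseudoEMetricSpace Y] {A : Set X}
    {B : Set Y} {r η : ℝ} (hr0 : 0 < r) (hr1 : r < 1)
    (h : (coverNum r A : ℝ≥0∞) ≤ coverNum r B * ENNReal.ofReal (r ^ (-η))) :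
    boxRatio A r ≤ boxRatio B r + η := by
  have hl : 0 < -Real.log r := neg_pos.2 (Real.log_neg hr0 hr1)
  have hl' : (0 : EReal) < ((-Real.log r : ℝ) : EReal) := by exact_mod_cast hl
  unfold boxRatio
  refine (EReal.div_le_div_right_of_nonneg hl'.le (ENNReal.log_le_log h)).trans ?_
  rw [ENNReal.log_mul_add, ENNReal.log_ofReal_of_pos (Real.rpow_pos_of_pos hr0 _),
    Real.log_rpow hr0, EReal.add_div_of_nonneg_right hl'.le, ← EReal.coe_div]
  gcongr
  rw [show -η * Real.log r = η * (-Real.log r) by ring, mul_div_cancel_right₀ _ hl.ne']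

theorem upperBoxDim_le_add {X Y : Type*} [PseudoEMetricSpace X] [PseudoEMetricSpace Y] {A : Set X}
    {B : Set Y} {η : ℝ} (h : ∀ᶠ r in 𝓝[>] (0 : ℝ),
      (coverNum r A : ℝ≥0∞) ≤ coverNum r B * ENNReal.ofReal (r ^ (-η))) :
    upperBoxDim A ≤ upperBoxDim B + η := by
  have h1 : ∀ᶠ r in 𝓝[>] (0 : ℝ), boxRatio A r ≤ (boxRatio B + fun _ : ℝ => (η : EReal)) r := by
    filter_upwards [h, Ioo_mem_nhdsGT (zero_lt_one' ℝ)] with r hr hr'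
    exact boxRatio_le_add hr'.1 hr'.2 hr
  refine (limsup_le_limsup h1).trans ((EReal.limsup_add_le ?_ ?_).trans ?_) <;> simp [upperBoxDim]

theorem lowerBoxDim_le_add {X Y : Type*} [PseudoEMetricSpace X] [PseudoEMetricSpace Y] {A : Set X}
    {B : Set Y} {η : ℝ} (h : ∀ᶠ r in 𝓝[>] (0 : ℝ),
      (coverNum r A : ℝ≥0∞) ≤ coverNum r B * ENNReal.ofReal (r ^ (-η))) :
    lowerBoxDim A ≤ lowerBoxDim B + η := by
  -- The constant comes first because `EReal.liminf_add_le` bounds by the limsup of the first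
  -- summand plus the liminf of the second.
  have h1 : ∀ᶠ r in 𝓝[>] (0 : ℝ), boxRatio A r ≤ ((fun _ : ℝ => (η : EReal)) + boxRatio B) r := by
    filter_upwards [h, Ioo_mem_nhdsGT (zero_lt_one' ℝ)] with r hr hr'
    simpa [add_comm] using boxRatio_le_add hr'.1 hr'.2 hr
  refine (liminf_le_liminf h1).trans ((EReal.liminf_add_le ?_ ?_).trans ?_) <;>
    simp [lowerBoxDim, add_comm]

theorem upperBoxDim_le_of_coverNum_le {X Y : Type*} [PseudoEMetricSpace X] [PseudoEMetricSpace Y]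
    {A : Set X} {B : Set Y} (h : ∀ r, coverNum r A ≤ coverNum r B) :
    upperBoxDim A ≤ upperBoxDim B := by
  have := upperBoxDim_le_add (A := A) (B := B) (η := 0)
    (Eventually.of_forall fun r => by simpa using h r)
  simpa using this

theorem lowerBoxDim_le_of_coverNum_le {X Y : Type*} [PseudoEMetricSpace X] [PseudoEMetricSpace Y]
    {A : Set X} {B : Set Y} (h : ∀ r, coverNum r A ≤ coverNum r B) :
    lowerBoxDim A ≤ lowerBoxDim B := by
  have := lowerBoxDim_le_add (A := A) (B := B) (η := 0)
    (Eventually.of_forall fun r => by simpa using h r)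
  simpa using this

theorem upperBoxDim_mono {X : Type*} [PseudoEMetricSpace X] {A B : Set X} (h : A ⊆ B) :
    upperBoxDim A ≤ upperBoxDim B :=
  upperBoxDim_le_of_coverNum_le fun _ => coverNum_mono h

theorem lowerBoxDim_le_upperBoxDim {X : Type*} [PseudoEMetricSpace X] (A : Set X) :
    lowerBoxDim A ≤ upperBoxDim A :=
  liminf_le_limsup

theorem upperBoxDim_le_of_eventually_le {X : Type*} [PseudoEMetricSpace X] {A : Set X} {K : ℝ}
    {s : ℕ} (h : ∀ᶠ r in 𝓝[>] (0 : ℝ), (coverNum r A : ℝ≥0∞) ≤ ENNReal.ofReal (K * (r ^ s)⁻¹)) :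
    upperBoxDim A ≤ s := by
  refine EReal.le_of_forall_lt_iff_le.1 fun η hη => ?_
  have hη : (s : ℝ) < η := by exact_mod_cast hη
  have hlim : Tendsto (fun r : ℝ => K * r ^ (η - s)) (𝓝[>] 0) (𝓝 0) := by
    have h1 : ContinuousAt (fun r : ℝ => K * r ^ (η - s)) 0 :=
      continuousAt_const.mul (Real.continuousAt_rpow_const _ _ (Or.inr (sub_pos.2 hη).le))
    have h2 := h1.tendsto
    rw [Real.zero_rpow (sub_pos.2 hη).ne', mul_zero] at h2
    exact h2.mono_left nhdsWithin_le_nhds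
  refine limsup_le_of_le (h := ?_)
  filter_upwards [h, Ioo_mem_nhdsGT (zero_lt_one' ℝ), hlim.eventually (eventually_le_nhds one_pos)]
    with r hr ⟨hr0, hr1⟩ hr2
  have hl : 0 < -Real.log r := neg_pos.2 (Real.log_neg hr0 hr1)
  have hl' : (0 : EReal) < ((-Real.log r : ℝ) : EReal) := by exact_mod_cast hl
  refine (EReal.div_le_iff_le_mul hl' (EReal.coe_ne_top _)).2 ?_
  have h3 : K * (r ^ s)⁻¹ ≤ r ^ (-η) := by
    rw [Real.rpow_sub hr0, Real.rpow_natCast] at hr2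
    rw [Real.rpow_neg hr0.le]
    have := Real.rpow_pos_of_pos hr0 η
    field_simp
    have h4 := pow_pos hr0 s
    field_simp at hr2
    linarith
  refine (ENNReal.log_le_log (hr.trans (ENNReal.ofReal_le_ofReal h3))).trans ?_
  rw [ENNReal.log_ofReal_of_pos (Real.rpow_pos_of_pos hr0 _), Real.log_rpow hr0, ← EReal.coe_mul]
  exact_mod_cast (by ring : -η * Real.log r = -Real.log r * η).le

/-! ### Bounded subsets of a subspace -/

/-- Volume comparison: the balls of radius ρ/2 about the points are disjoint and lie in the ball of
radius ρ/2 + D. -/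
theorem card_mul_pow_le_of_separated {W : Type*} [NormedAddCommGroup W] [NormedSpace ℝ W]
    [FiniteDimensional ℝ W] (P : Finset W) {D ρ : ℝ} (hρ : 0 < ρ) (hD : 0 ≤ D)
    (hPD : ∀ x ∈ P, ‖x‖ ≤ D) (hP : (P : Set W).Pairwise fun x y => ρ < dist x y) :
    (P.card : ℝ) * (ρ / 2) ^ Module.finrank ℝ W ≤ (ρ / 2 + D) ^ Module.finrank ℝ W := by
  borelize W
  let μ : Measure W := Measure.addHaar
  have hdisj : (P : Set W).PairwiseDisjoint fun c => Metric.ball c (ρ / 2) := fun c hc d hd hcd =>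
    Metric.ball_disjoint_ball (by linarith [hP hc hd hcd])
  have hsub : (⋃ c ∈ P, Metric.ball c (ρ / 2)) ⊆ Metric.ball (0 : W) (ρ / 2 + D) :=
    iUnion₂_subset fun x hx => Metric.ball_subset_ball' (by
      rw [dist_zero_right]; linarith [hPD x hx])
  have h1 := measure_mono (μ := μ) hsub
  rw [measure_biUnion_finset hdisj fun c _ => measurableSet_ball] at h1
  simp only [μ.addHaar_ball_of_pos _ (half_pos hρ), Finset.sum_const, nsmul_eq_mul, ← mul_assoc,
    μ.addHaar_ball_of_pos _ (by positivity : 0 < ρ / 2 + D)] at h1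
  have h2 := (ENNReal.mul_le_mul_iff_left (Metric.measure_ball_pos _ _ zero_lt_one).ne'
    measure_ball_lt_top.ne).1 h1
  have h3 := ENNReal.toReal_le_of_le_ofReal (by positivity) h2
  rwa [ENNReal.toReal_mul, ENNReal.toReal_ofReal (by positivity), ENNReal.toReal_natCast] at h3

theorem upperBoxDim_le_finrank {n : ℕ} (V : Submodule ℝ (E n)) {A : Set (E n)} (hAV : A ⊆ V)
    (hA : Bornology.IsBounded A) : upperBoxDim A ≤ Module.finrank ℝ V := by
  classical
  obtain ⟨D, hD0, hD⟩ := hA.exists_pos_norm_le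
  refine upperBoxDim_le_of_eventually_le (K := (2 + 4 * D) ^ Module.finrank ℝ V) ?_
  filter_upwards [Ioo_mem_nhdsGT (zero_lt_one' ℝ)] with r ⟨hr0, hr1⟩
  obtain ⟨P, hPA, hP, hcov⟩ := exists_maximal_separated
    (hA.isCompact_closure.totallyBounded.subset subset_closure) (half_pos hr0)
  have h1 := coverNum_two_mul_le_card hcov
  rw [mul_div_cancel₀ _ two_ne_zero] at h1
  -- The volumes are compared inside V, so that the exponent is the dimension of V rather than n.
  have h2 := card_mul_pow_le_of_separated (W := V) (P.subtype (· ∈ V)) (half_pos hr0) hD0.le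
    (fun x hx => hD x (hPA (by simpa using hx)))
    (fun x hx y hy hxy => hP (by simpa using hx) (by simpa using hy) (by simpa using hxy))
  rw [Finset.card_subtype, Finset.filter_true_of_mem (p := (· ∈ V)) fun x hx => hAV (hPA hx)] at h2
  have h3 : (P.card : ℝ) ≤ (2 + 4 * D) ^ Module.finrank ℝ V * (r ^ Module.finrank ℝ V)⁻¹ := by
    rw [← div_eq_mul_inv, ← div_pow]
    rw [← le_div_iff₀ (by positivity), ← div_pow] at h2
    refine h2.trans (pow_le_pow_left₀ (by positivity) ?_ _)
    rw [div_le_div_iff₀ (by positivity) hr0]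
    nlinarith [mul_pos hr0 hD0]
  calc (coverNum r A : ℝ≥0∞) ≤ ((P.card : ℕ∞) : ℝ≥0∞) := by exact_mod_cast h1
    _ = ENNReal.ofReal P.card := by simp
    _ ≤ _ := ENNReal.ofReal_le_ofReal h3

/-! ### The measure of the subspaces on which a given vector projects to a short vector -/

theorem norm_starProjection_rotate {n m : ℕ} (g : O n) (V : Gr n m) (z : E n) :
    ‖(rotate g V).1.starProjection z‖ = ‖V.1.starProjection (star (g : E n →L[ℝ] E n) z)‖ := by
  rw [starProjection_rotate]
  exact Unitary.norm_map g _

theorem continuous_starProjection_apply {n m : ℕ} (z : E n) :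
    Continuous fun V : Gr n m => V.1.starProjection z := by
  have h : Continuous fun V : Gr n m => V.1.starProjection := continuous_induced_dom
  exact h.clm_apply continuous_const

theorem measurableSet_norm_starProjection_le {n m : ℕ} (z : E n) (a : ℝ) :
    MeasurableSet {V : Gr n m | ‖V.1.starProjection z‖ ≤ a} :=
  (isClosed_le (continuous_starProjection_apply z).norm continuous_const).measurableSet

theorem apply_starProjection_coordSubspace {n m : ℕ} (h : m ≤ n) (z : E n) (i : Fin m) :
    ((coordSubspace h).1.starProjection z) (Fin.castLE h i) = z (Fin.castLE h i) := by
  have hmem : (EuclideanSpace.single (Fin.castLE h i) (1 : ℝ) : E n) ∈ (coordSubspace h).1 :=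
    Submodule.subset_span ⟨i, rfl⟩
  have := (coordSubspace h).1.starProjection_inner_eq_zero z _ hmem
  rw [EuclideanSpace.inner_single_right] at this
  simp only [PiLp.sub_apply, map_sub, conj_trivial, one_mul] at this
  linarith

theorem exists_unitary_apply_eq {n : ℕ} {z w : E n} (h : ‖z‖ = ‖w‖) :
    ∃ g : O n, (g : E n →L[ℝ] E n) z = w :=
  ⟨Unitary.linearIsometryEquiv.symm (Submodule.reflection (ℝ ∙ (z - w))ᗮ),
    Submodule.reflection_sub h⟩

theorem grMeasure_norm_starProjection_le_eq {n m : ℕ} (h : m ≤ n) {z w : E n} (hzw : ‖z‖ = ‖w‖)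
    (a : ℝ) : grMeasure h {V : Gr n m | ‖V.1.starProjection z‖ ≤ a} =
      grMeasure h {V : Gr n m | ‖V.1.starProjection w‖ ≤ a} := by
  obtain ⟨g, hg⟩ := exists_unitary_apply_eq hzw
  conv_rhs => rw [← map_rotate_grMeasure h g, Measure.map_apply
    (continuous_rotate_right g).measurable (measurableSet_norm_starProjection_le _ _)]
  congr 1
  ext V
  simp only [mem_ofPred_eq, mem_preimage, norm_starProjection_rotate, ← hg]
  have : star (g : E n →L[ℝ] E n) ((g : E n →L[ℝ] E n) z) = z :=
    congr($(Unitary.star_mul_self g).val z)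
  rw [this]

theorem grMeasure_norm_starProjection_smul {n m : ℕ} (h : m ≤ n) {z : E n} {t : ℝ} (ht : 0 < t)
    (δ : ℝ) : grMeasure h {V : Gr n m | ‖V.1.starProjection (t • z)‖ ≤ δ * ‖t • z‖} =
      grMeasure h {V : Gr n m | ‖V.1.starProjection z‖ ≤ δ * ‖z‖} := by
  congr 1
  ext V
  simp only [mem_ofPred_eq, map_smul, norm_smul, Real.norm_of_nonneg ht.le]
  rw [mul_left_comm, mul_le_mul_iff_right₀ ht]

/-- In the unit ball the condition forces the first m coordinates into [-δ, δ] and the others into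
[-1, 1]. -/
theorem volume_slab_le {n m : ℕ} (h : m ≤ n) {δ : ℝ} (hδ : 0 ≤ δ) :
    volume {w : E n | w ∈ Metric.ball 0 1 ∧ ‖(coordSubspace h).1.starProjection w‖ ≤ δ * ‖w‖} ≤
      ENNReal.ofReal (2 ^ n * δ ^ m) := by
  have hsub : {w : E n | w ∈ Metric.ball 0 1 ∧
      ‖(coordSubspace h).1.starProjection w‖ ≤ δ * ‖w‖} ⊆
      (MeasurableEquiv.toLp 2 (Fin n → ℝ)).symm ⁻¹' Set.pi univ fun i : Fin n =>
        Icc (-(if (i : ℕ) < m then δ else 1)) (if (i : ℕ) < m then δ else 1) := by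
    rintro w ⟨hw1, hw⟩ i -
    rw [mem_ball_zero_iff] at hw1
    refine abs_le.1 ?_
    change |w i| ≤ _
    split_ifs with hi
    · have hi' : i = Fin.castLE h ⟨i, hi⟩ := rfl
      rw [hi', ← apply_starProjection_coordSubspace h w, ← Real.norm_eq_abs]
      refine (PiLp.norm_apply_le _ _).trans (hw.trans ?_)
      nlinarith [norm_nonneg w]
    · rw [← Real.norm_eq_abs]
      exact (PiLp.norm_apply_le w i).trans hw1.le
  refine (measure_mono hsub).trans ?_
  rw [(EuclideanSpace.volume_preserving_symm_measurableEquiv_toLp (Fin n)).measure_preimage_equiv,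
    volume_pi_pi]
  simp only [Real.volume_Icc]
  rw [← ENNReal.ofReal_prod_of_nonneg]
  swap
  · intro i _
    split_ifs <;> linarith
  refine ENNReal.ofReal_le_ofReal (le_of_eq ?_)
  have : ∀ i : Fin n, ((if (i : ℕ) < m then δ else 1) - -(if (i : ℕ) < m then δ else 1)) =
      2 * (if (i : ℕ) < m then δ else 1) := fun i => by ring
  simp only [this, Finset.prod_mul_distrib, Finset.prod_const, Finset.card_univ, Fintype.card_fin]
  congr 1
  rw [Finset.prod_ite]
  simp only [Finset.prod_const, one_pow, mul_one]
  congr 1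
  rw [Fin.card_filter_val_lt]
  exact min_eq_right h

/-- By rotation invariance and scaling the probability depends only on δ/‖z‖, so it equals its
average over all directions w in the unit ball. Fubini exchanges that average with the one over
O(n); for a fixed rotation, what remains is the volume of a slab. -/
theorem exists_grMeasure_norm_starProjection_le {n m : ℕ} (h : m ≤ n) :
    ∃ c : ℝ, 0 < c ∧ ∀ (z : E n), z ≠ 0 → ∀ δ : ℝ, 0 ≤ δ →
      grMeasure h {V : Gr n m | ‖V.1.starProjection z‖ ≤ δ} ≤
        ENNReal.ofReal (c * (δ / ‖z‖) ^ m) := by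
  have hB0 : (volume (Metric.ball (0 : E n) 1)) ≠ 0 :=
    (Metric.measure_ball_pos _ _ one_pos).ne'
  have hB1 : (volume (Metric.ball (0 : E n) 1)) ≠ ⊤ := measure_ball_lt_top.ne
  set b : ℝ := (volume (Metric.ball (0 : E n) 1)).toReal with hb
  have hb0 : 0 < b := ENNReal.toReal_pos hB0 hB1
  refine ⟨2 ^ n / b, by positivity, fun z hz δ hδ => ?_⟩
  have : Nontrivial (E n) := ⟨z, 0, hz⟩
  have hz' : 0 < ‖z‖ := norm_pos_iff.2 hz
  set ε : ℝ := δ / ‖z‖ with hε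
  have hε0 : 0 ≤ ε := by positivity
  have hδε : δ = ε * ‖z‖ := by rw [hε]; field_simp
  rw [hδε]
  set Φ := grMeasure h {V : Gr n m | ‖V.1.starProjection z‖ ≤ ε * ‖z‖} with hΦ
  have hconst : ∀ w : E n, w ≠ 0 →
      grMeasure h {V : Gr n m | ‖V.1.starProjection w‖ ≤ ε * ‖w‖} = Φ := by
    intro w hw
    have hw' : 0 < ‖w‖ := norm_pos_iff.2 hw
    rw [hΦ, ← grMeasure_norm_starProjection_smul h (z := z) (div_pos hw' hz')]
    have hn : ‖w‖ = ‖(‖w‖ / ‖z‖) • z‖ := by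
      rw [norm_smul, Real.norm_of_nonneg (by positivity)]
      field_simp
    rw [← hn, grMeasure_norm_starProjection_le_eq h hn]
  let μ : Measure (O n) := Measure.haarMeasure (⊤ : TopologicalSpace.PositiveCompacts (O n))
  have hprob : IsProbabilityMeasure μ := ⟨by
    simpa using Measure.haarMeasure_self (K₀ := (⊤ : TopologicalSpace.PositiveCompacts (O n)))⟩
  let S : Set (O n × E n) := {p | ‖(coordSubspace h).1.starProjection
    (star (p.1 : E n →L[ℝ] E n) p.2)‖ ≤ ε * ‖p.2‖}
  have hS : MeasurableSet S := by
    refine (isClosed_le ?_ ?_).measurableSet <;> fun_prop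
  let ν : Measure (E n) := volume.restrict (Metric.ball 0 1)
  have h1 : (μ.prod ν) S = Φ * volume (Metric.ball (0 : E n) 1) := by
    rw [Measure.prod_apply_symm hS]
    have : ∀ᵐ w ∂ν, μ ((fun g => (g, w)) ⁻¹' S) = Φ := by
      refine ae_restrict_of_ae ?_
      filter_upwards [compl_mem_ae_iff.2 (measure_singleton (μ := volume) (0 : E n))] with w hw
      rw [← hconst w hw, grMeasure, Measure.map_apply
        (continuous_rotate_left (coordSubspace h)).measurable
        (measurableSet_norm_starProjection_le _ _)]
      congr 1
      ext g
      simp only [mem_ofPred_eq, mem_preimage, norm_starProjection_rotate, S]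
    rw [lintegral_congr_ae this]
    simp [ν]
  have h2 : (μ.prod ν) S ≤ ENNReal.ofReal (2 ^ n * ε ^ m) := by
    rw [Measure.prod_apply hS]
    calc ∫⁻ g, ν (Prod.mk g ⁻¹' S) ∂μ ≤ ∫⁻ _, ENNReal.ofReal (2 ^ n * ε ^ m) ∂μ := by
          refine lintegral_mono fun g => ?_
          refine le_trans (le_of_eq ?_) (volume_slab_le h hε0)
          rw [Measure.restrict_apply (measurable_prodMk_left hS)]
          let e := Unitary.linearIsometryEquiv (star g)
          conv_rhs => rw [← (show MeasurePreserving e.toMeasurableEquiv volume volume from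
            e.measurePreserving).measure_preimage_equiv]
          congr 1
          ext w
          have he : ‖e w‖ = ‖w‖ := e.norm_map w
          have he' : e w = star (g : E n →L[ℝ] E n) w := rfl
          simp only [mem_inter_iff, mem_preimage, mem_ofPred_eq, mem_ball_zero_iff, S,
            LinearIsometryEquiv.coe_toMeasurableEquiv, he]
          rw [he', and_comm]
      _ = _ := by simp
  rw [h1] at h2
  have h3 : Φ ≤ ENNReal.ofReal (2 ^ n * ε ^ m) / volume (Metric.ball (0 : E n) 1) :=
    (ENNReal.le_div_iff_mul_le (Or.inl hB0) (Or.inl hB1)).2 h2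
  refine h3.trans (le_of_eq ?_)
  rw [← ENNReal.ofReal_toReal hB1, ← ENNReal.ofReal_div_of_pos hb0]
  congr 1
  ring

/-! ### Counting pairs of points -/

theorem exists_cover_card_eq {X : Type*} [PseudoEMetricSpace X] {r : ℝ} {A : Set X}
    (h : coverNum r A ≠ ⊤) : ∃ C : Finset (Set X), A ⊆ ⋃ U ∈ C, U ∧
      (∀ U ∈ C, Metric.ediam U ≤ ENNReal.ofReal r) ∧ (C.card : ℕ∞) = coverNum r A := by
  by_contra! hne
  -- If no cover attained the infimum, every cover would have at least one set more than the
  -- infimum.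
  have : coverNum r A + 1 ≤ coverNum r A := le_iInf fun C => le_iInf₂ fun hA hC =>
    Order.add_one_le_of_lt ((coverNum_le_card C hA hC).lt_of_ne (hne C hA hC).symm)
  exact absurd ((ENat.lt_add_one_iff h).2 le_rfl) (not_lt.2 this)

/-- Each point of P is assigned to one set of an optimal cover that contains its image. Two points
with the same assignment form a close pair, and Cauchy–Schwarz bounds |P|² by the number of cells
times the sum of squared cell sizes. -/
theorem sq_card_le_coverNum_mul {X Y : Type*} [PseudoMetricSpace Y] {f : X → Y} {A : Set X}
    {P : Finset X} (hP : ↑P ⊆ A) {δ : ℝ} (hδ : 0 ≤ δ) :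
    (P.card : ℝ≥0∞) ^ 2 ≤ (coverNum δ (f '' A) : ℝ≥0∞) *
      (({p ∈ P ×ˢ P | dist (f p.1) (f p.2) ≤ δ} : Finset (X × X)).card : ℝ≥0∞) := by
  classical
  set Q : Finset (X × X) := {p ∈ P ×ˢ P | dist (f p.1) (f p.2) ≤ δ} with hQ
  rcases P.eq_empty_or_nonempty with rfl | ⟨x₀, hx₀⟩
  · simp
  by_cases htop : coverNum δ (f '' A) = ⊤
  · have hQ0 : Q.card ≠ 0 := Finset.card_ne_zero_of_mem (a := (x₀, x₀)) (by simp [hQ, hx₀, hδ])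
    rw [htop, ENat.toENNReal_top, ENNReal.top_mul (by exact_mod_cast hQ0)]
    exact le_top
  obtain ⟨C, hA, hC, hcard⟩ := exists_cover_card_eq htop
  have h : ∀ x ∈ P, ∃ U ∈ C, f x ∈ U := fun x hx => by
    simpa using hA (mem_image_of_mem f (hP hx))
  choose! g hgC hg using h
  have h1 : P.card = ∑ U ∈ C, ({x ∈ P | g x = U} : Finset X).card :=
    Finset.card_eq_sum_card_fiberwise hgC
  have h2 : ∑ U ∈ C, ({x ∈ P | g x = U} : Finset X).card ^ 2 ≤ Q.card := by
    rw [Finset.card_eq_sum_card_fiberwise (f := fun p => g p.1) (s := Q) (t := C)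
      fun p hp => hgC _ (Finset.mem_product.1 (Finset.mem_filter.1 hp).1).1]
    refine Finset.sum_le_sum fun U hU => ?_
    rw [sq, ← Finset.card_product]
    refine Finset.card_le_card fun p hp => ?_
    simp only [Finset.mem_product, Finset.mem_filter, hQ] at hp ⊢
    refine ⟨⟨⟨hp.1.1, hp.2.1⟩, ?_⟩, hp.1.2⟩
    have h3 := (Metric.edist_le_ediam_of_mem (hp.1.2 ▸ hg _ hp.1.1)
      (hp.2.2 ▸ hg _ hp.2.1)).trans (hC U hU)
    rwa [edist_dist, ENNReal.ofReal_le_ofReal_iff hδ] at h3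
  have h3 : P.card ^ 2 ≤ C.card * Q.card := by
    rw [h1]
    exact (sq_sum_le_card_mul_sum_sq).trans (Nat.mul_le_mul_left _ h2)
  rw [← hcard]
  exact_mod_cast h3

/-- The spectrum only controls radii with ρ ≤ R^{1/θ} and R < 1. A smaller radius is enlarged to
ρ^θ, which costs (ρ^θ/ρ)^α = ρ^{-(1-θ)α}; for R ≥ 1/2, finitely many balls of radius 1/2 cover F. -/
theorem exists_card_le_of_isSpectrumExponent {X : Type*} [PseudoMetricSpace X] {F : Set X}
    (hF : TotallyBounded F) {θ α : ℝ} (hθ0 : 0 < θ) (hθ1 : θ < 1) (hα : 0 ≤ α)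
    (h : IsSpectrumExponent θ F α) :
    ∃ K : ℝ, 0 < K ∧ ∃ ρ₀ : ℝ, 0 < ρ₀ ∧ ∀ ρ, 0 < ρ → ρ ≤ ρ₀ → ∀ P : Finset X, ↑P ⊆ F →
      ((P : Set X).Pairwise fun x y => ρ < dist x y) → ∀ x ∈ F, ∀ R, ρ ≤ R →
        (({y ∈ P | dist y x ≤ R} : Finset X).card : ℝ) ≤
          K * ρ ^ (-((1 - θ) * α)) * (R / ρ) ^ α := by
  classical
  obtain ⟨C, hC, H⟩ := h
  obtain ⟨t, htF, htfin, ht⟩ := Metric.finite_approx_of_totallyBounded hF (1 / 2) (by norm_num)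
  have hθi : 1 < 1 / θ := (one_lt_div hθ0).2 hθ1
  have hball : ∀ ρ R, 0 < ρ → ρ ≤ R ^ (1 / θ) → 0 < R → R < 1 → ∀ P : Finset X, ↑P ⊆ F →
      ((P : Set X).Pairwise fun x y => ρ < dist x y) → ∀ x ∈ F,
      (({y ∈ P | dist y x ≤ R} : Finset X).card : ℝ) ≤ C * (R / ρ) ^ α := by
    intro ρ R hρ hρR hR0 hR1 P hPF hP x hx
    have hRR : R ^ (1 / θ) < R := by
      simpa using Real.rpow_lt_rpow_of_exponent_gt hR0 hR1 hθi
    have h1 := H ρ R hρ hρR hRR hR1 x hx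
    have h2 : ((({y ∈ P | dist y x ≤ R} : Finset X).card : ℕ∞) : ℝ≥0∞) ≤
        coverNum ρ (Metric.closedBall x R ∩ F) := by
      have := card_le_coverNum hρ.le (A := Metric.closedBall x R ∩ F)
        (P := {y ∈ P | dist y x ≤ R})
        (fun y hy => by
          have hy := Finset.mem_filter.1 (Finset.mem_coe.1 hy)
          exact ⟨hy.2, hPF hy.1⟩)
        (hP.mono fun y hy => (Finset.mem_filter.1 (Finset.mem_coe.1 hy)).1)
      exact_mod_cast this
    have h3 := ENNReal.toReal_le_of_le_ofReal (by positivity) (h2.trans h1)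
    simpa using h3
  -- The bound on ρ makes the radius 1/2 admissible; the cardinality in the constant counts the
  -- balls of radius 1/2.
  refine ⟨C * (htfin.toFinset.card + 1), by positivity, (1 / 2) ^ (1 / θ), by positivity,
    fun ρ hρ hρ0 P hPF hP x hx R hR => ?_⟩
  have hρ1 : ρ < 1 := hρ0.trans_lt (Real.rpow_lt_one (by norm_num) (by norm_num) (by positivity))
  have hR0 : 0 < R := hρ.trans_le hR
  have hpow : 1 ≤ ρ ^ (-((1 - θ) * α)) :=
    Real.one_le_rpow_of_pos_of_le_one_of_nonpos hρ hρ1.le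
      (neg_nonpos.2 (mul_nonneg (sub_nonneg.2 hθ1.le) hα))
  have hRρ : 1 ≤ (R / ρ) ^ α := Real.one_le_rpow ((one_le_div hρ).2 hR) hα
  set T : ℝ := (htfin.toFinset.card : ℝ) with hT
  have hT0 : 0 ≤ T := by positivity
  rcases lt_or_ge R (1 / 2) with hR2 | hR2
  · rcases le_or_gt ρ (R ^ (1 / θ)) with hc | hc
    · refine (hball ρ R hρ hc hR0 (by linarith) P hPF hP x hx).trans ?_
      have h0 : 0 ≤ (R / ρ) ^ α := by linarith
      refine mul_le_mul_of_nonneg_right ?_ h0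
      calc C = C * 1 * 1 := by ring
        _ ≤ _ := by gcongr; linarith
    · have hRρ' : R ≤ ρ ^ θ := by
        have := Real.rpow_le_rpow (by positivity) hc.le hθ0.le
        rwa [← Real.rpow_mul hR0.le, one_div, inv_mul_cancel₀ hθ0.ne', Real.rpow_one] at this
      have h1 := hball ρ (ρ ^ θ) hρ
        (by rw [← Real.rpow_mul hρ.le, mul_one_div_cancel hθ0.ne', Real.rpow_one])
        (by positivity) (Real.rpow_lt_one hρ.le hρ1 hθ0) P hPF hP x hx
      have h2 : (({y ∈ P | dist y x ≤ R} : Finset X).card : ℝ) ≤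
          ({y ∈ P | dist y x ≤ ρ ^ θ} : Finset X).card := by
        exact_mod_cast Finset.card_le_card
          (Finset.monotone_filter_right _ fun y _ hy => le_trans hy hRρ')
      refine (h2.trans h1).trans ?_
      have h3 : (ρ ^ θ / ρ) ^ α = ρ ^ (-((1 - θ) * α)) := by
        rw [← Real.rpow_sub_one hρ.ne', ← Real.rpow_mul hρ.le]
        congr 1
        ring
      rw [h3]
      calc C * ρ ^ (-((1 - θ) * α)) = C * 1 * ρ ^ (-((1 - θ) * α)) * 1 := by ring
        _ ≤ _ := by gcongr; linarith
  · have h1 : ({y ∈ P | dist y x ≤ R} : Finset X).card ≤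
        ∑ z ∈ htfin.toFinset, ({y ∈ P | dist y z ≤ 1 / 2} : Finset X).card := by
      refine (Finset.card_le_card (t := htfin.toFinset.biUnion
        fun z => {y ∈ P | dist y z ≤ 1 / 2}) fun y hy => ?_).trans Finset.card_biUnion_le
      have hyP := (Finset.mem_filter.1 hy).1
      obtain ⟨z, hz, hyz⟩ := mem_iUnion₂.1 (ht (hPF hyP))
      exact Finset.mem_biUnion.2 ⟨z, by simpa using hz,
        Finset.mem_filter.2 ⟨hyP, (Metric.mem_ball.1 hyz).le⟩⟩
    have h2 : ∀ z ∈ htfin.toFinset, (({y ∈ P | dist y z ≤ 1 / 2} : Finset X).card : ℝ) ≤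
        C * (R / ρ) ^ α := fun z hz => by
      refine (hball ρ (1 / 2) hρ hρ0 (by norm_num) (by norm_num) P hPF hP z
        (htF (by simpa using hz))).trans ?_
      gcongr
    have h3 : (({y ∈ P | dist y x ≤ R} : Finset X).card : ℝ) ≤ T * (C * (R / ρ) ^ α) := by
      refine (Nat.cast_le.2 h1).trans ?_
      push_cast
      refine (Finset.sum_le_sum h2).trans ?_
      simp [hT]
    refine h3.trans ?_
    calc T * (C * (R / ρ) ^ α) = C * T * 1 * (R / ρ) ^ α := by ring
      _ ≤ _ := by gcongr; linarith

/-- A dyadic decomposition of the bound on the measure of the subspaces `V` for which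
`‖π_V z‖ ≤ δ`. -/
theorem exists_grMeasure_le_sum {n m : ℕ} (h : m ≤ n) :
    ∃ c : ℝ, 0 < c ∧ ∀ (z : E n) (δ : ℝ) (M : ℕ), 0 < δ → ‖z‖ ≤ 2 ^ M * δ →
      (grMeasure h).real {V : Gr n m | ‖V.1.starProjection z‖ ≤ δ} ≤
        c * ∑ j ∈ Finset.range (M + 2), ((2 : ℝ) ^ j)⁻¹ ^ m *
          if ‖z‖ ≤ 2 ^ j * δ then 1 else 0 := by
  obtain ⟨c, hc, H⟩ := exists_grMeasure_norm_starProjection_le h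
  -- The 1 serves ‖z‖ ≤ δ, where the term j = 0 beats the trivial bound. Otherwise 2^j δ ≤ ‖z‖ <
  -- 2^{j+1} δ, and the term j + 1 is used at the cost of 2^m; hence the range up to M + 1.
  refine ⟨max 1 (c * 2 ^ m), by positivity, fun z δ M hδ hz => ?_⟩
  set a : ℕ → ℝ := fun j => ((2 : ℝ) ^ j)⁻¹ ^ m * if ‖z‖ ≤ 2 ^ j * δ then 1 else 0 with ha
  have ha0 : ∀ j, 0 ≤ a j := fun j => by
    simp only [ha]
    split_ifs <;> positivity
  have hle : ∀ j, j < M + 2 → a j ≤ ∑ j ∈ Finset.range (M + 2), a j := fun j hj =>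
    Finset.single_le_sum (fun i _ => ha0 i) (Finset.mem_range.2 hj)
  rcases le_or_gt ‖z‖ δ with hzδ | hzδ
  · have h1 : a 0 = 1 := by simp [ha, hzδ]
    calc _ ≤ (1 : ℝ) := measureReal_le_one
      _ = 1 * a 0 := by rw [h1, one_mul]
      _ ≤ _ := mul_le_mul (le_max_left _ _) (hle 0 (by lia)) (ha0 0) (by positivity)
  · obtain ⟨j, hj1, hj2⟩ := exists_nat_pow_near ((one_le_div hδ).2 hzδ.le) (one_lt_two (α := ℝ))
    rw [le_div_iff₀ hδ] at hj1
    rw [div_lt_iff₀ hδ] at hj2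
    have hz0 : 0 < ‖z‖ := hδ.trans hzδ
    have hjM : j ≤ M := by
      have : (2 : ℝ) ^ j ≤ 2 ^ M := le_of_mul_le_mul_right (hj1.trans hz) hδ
      exact (pow_le_pow_iff_right₀ one_lt_two).1 this
    have h1 : a (j + 1) = ((2 : ℝ) ^ (j + 1))⁻¹ ^ m := by simp [ha, hj2.le]
    have h2 := ENNReal.toReal_le_of_le_ofReal (by positivity)
      (H z (norm_pos_iff.1 hz0) δ hδ.le)
    calc _ ≤ c * (δ / ‖z‖) ^ m := h2
      _ ≤ c * (((2 : ℝ) ^ j)⁻¹) ^ m := by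
        gcongr
        rw [div_le_iff₀ hz0, inv_mul_eq_div, le_div_iff₀ (by positivity)]
        linarith
      _ = c * 2 ^ m * a (j + 1) := by
        rw [h1, mul_assoc, ← mul_pow]
        congr 2
        rw [pow_succ]
        field_simp
      _ ≤ _ := mul_le_mul (le_max_right _ _) (hle (j + 1) (by lia)) (ha0 _) (by positivity)

/-- The expected number of pairs of points whose projections are close. -/
theorem exists_sum_grMeasure_le {n m : ℕ} (h : m ≤ n) {F : Set (E n)}
    (hF : Bornology.IsBounded F) {θ α : ℝ} (hθ0 : 0 < θ) (hθ1 : θ < 1) (hα : 0 ≤ α)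
    (hs : IsSpectrumExponent θ F α) :
    ∃ A : ℝ, 0 < A ∧ ∃ L : ℕ, ∀ᶠ k : ℕ in atTop, ∀ P : Finset (E n), ↑P ⊆ F →
      ((P : Set (E n)).Pairwise fun x y => (1 / 2) ^ k / 4 < dist x y) →
      ∑ p ∈ P ×ˢ P, (grMeasure h).real
          {V : Gr n m | dist (V.1.starProjection p.1) (V.1.starProjection p.2) ≤ (1 / 2) ^ k} ≤
        P.card * (A * (k + L + 2) *
          (((1 / 2 : ℝ) ^ k) ^ (-((1 - θ) * α + max 0 (α - m))))) := by
  classical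
  have hFc : TotallyBounded F := hF.isCompact_closure.totallyBounded.subset subset_closure
  obtain ⟨K, hK, ρ₀, hρ₀, hcount⟩ := exists_card_le_of_isSpectrumExponent hFc hθ0 hθ1 hα hs
  obtain ⟨c, hc, hgr⟩ := exists_grMeasure_le_sum h
  obtain ⟨D, hD0, hD⟩ := hF.exists_pos_norm_le
  -- With 2^L > 2D, all differences of points of F have norm at most 2^{k+L} δ.
  obtain ⟨L, hL⟩ := pow_unbounded_of_one_lt (2 * D) (one_lt_two (α := ℝ))
  set ε := (1 - θ) * α with hε
  set β := max 0 (α - m) with hβ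
  have hβ0 : 0 ≤ β := le_max_left _ _
  refine ⟨c * K * 4 ^ ε * 4 ^ α * ((2 : ℝ) ^ (L + 1)) ^ β, by positivity, L, ?_⟩
  have hlim : Tendsto (fun k : ℕ => (1 / 2 : ℝ) ^ k) atTop (𝓝 0) :=
    tendsto_pow_atTop_nhds_zero_of_lt_one (by norm_num) (by norm_num)
  filter_upwards [hlim.eventually (eventually_le_nhds hρ₀)] with k hk P hPF hP
  set δ : ℝ := (1 / 2) ^ k with hδ
  have hδ0 : 0 < δ := by positivity
  have h2kδ : (2 : ℝ) ^ k * δ = 1 := by rw [hδ, ← mul_pow]; norm_num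
  have hterm : ∀ x ∈ P, ∑ y ∈ P, (grMeasure h).real
      {V : Gr n m | dist (V.1.starProjection x) (V.1.starProjection y) ≤ δ} ≤
      c * K * 4 ^ ε * 4 ^ α * ((2 : ℝ) ^ (L + 1)) ^ β * (k + L + 2) * δ ^ (-(ε + β)) := by
    intro x hx
    have hxy : ∀ y ∈ P, (grMeasure h).real
        {V : Gr n m | dist (V.1.starProjection x) (V.1.starProjection y) ≤ δ} ≤
        c * ∑ j ∈ Finset.range (k + L + 2), ((2 : ℝ) ^ j)⁻¹ ^ m *
          if dist y x ≤ 2 ^ j * δ then 1 else 0 := by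
      intro y hy
      have h1 := hgr (y - x) δ (k + L) hδ0 (by
        rw [pow_add, mul_right_comm, h2kδ, one_mul]
        linarith [norm_sub_le y x, hD x (hPF hx), hD y (hPF hy)])
      simp only [map_sub, ← dist_eq_norm] at h1
      simpa only [dist_comm (Submodule.starProjection _ x)] using h1
    refine (Finset.sum_le_sum hxy).trans ?_
    rw [← Finset.mul_sum, Finset.sum_comm]
    have hj : ∀ j ∈ Finset.range (k + L + 2), ∑ y ∈ P, (((2 : ℝ) ^ j)⁻¹ ^ m *
        if dist y x ≤ 2 ^ j * δ then (1 : ℝ) else 0) ≤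
        K * 4 ^ ε * 4 ^ α * ((2 : ℝ) ^ (L + 1)) ^ β * δ ^ (-(ε + β)) := by
      intro j hj
      have hj' : j ≤ k + L + 1 := by have := Finset.mem_range.1 hj; lia
      have h2j : (1 : ℝ) ≤ 2 ^ j := one_le_pow₀ one_le_two
      rw [← Finset.mul_sum, Finset.sum_boole]
      have h1 := hcount (δ / 4) (by positivity) (by linarith) P hPF hP x (hPF hx) (2 ^ j * δ)
        (by nlinarith)
      have h2 : (2 : ℝ) ^ j * δ / (δ / 4) = 2 ^ j * 4 := by field_simp
      -- Every scale is bounded by the largest one, j = k + L + 1, after replacing α - m by β ≥ 0;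
      -- the number of scales gives only the factor k + L + 2.
      have h3 : ((2 : ℝ) ^ j)⁻¹ ^ m * ((2 : ℝ) ^ j) ^ α ≤ ((2 : ℝ) ^ (L + 1)) ^ β * δ ^ (-β) := by
        calc ((2 : ℝ) ^ j)⁻¹ ^ m * ((2 : ℝ) ^ j) ^ α = ((2 : ℝ) ^ j) ^ (α - m) := by
              rw [Real.rpow_sub (by positivity), Real.rpow_natCast, inv_pow, div_eq_inv_mul]
          _ ≤ ((2 : ℝ) ^ j) ^ β := Real.rpow_le_rpow_of_exponent_le h2j (le_max_right _ _)
          _ ≤ ((2 : ℝ) ^ (k + L + 1)) ^ β := by gcongr; norm_num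
          _ = ((2 : ℝ) ^ (L + 1) * δ⁻¹) ^ β := by
              congr 1
              rw [eq_mul_inv_iff_mul_eq₀ hδ0.ne', add_assoc, pow_add, mul_right_comm, h2kδ, one_mul]
          _ = _ := by
              rw [Real.mul_rpow (by positivity) (by positivity), Real.inv_rpow hδ0.le,
                Real.rpow_neg hδ0.le]
      rw [h2, Real.mul_rpow (by positivity) (by positivity), Real.div_rpow hδ0.le (by norm_num),
        Real.rpow_neg (by norm_num : (0 : ℝ) ≤ 4)] at h1
      calc _ ≤ ((2 : ℝ) ^ j)⁻¹ ^ m *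
            (K * (δ ^ (-ε) / (4 ^ ε)⁻¹) * (((2 : ℝ) ^ j) ^ α * 4 ^ α)) := by gcongr
        _ = K * 4 ^ ε * 4 ^ α * δ ^ (-ε) * (((2 : ℝ) ^ j)⁻¹ ^ m * ((2 : ℝ) ^ j) ^ α) := by
            field_simp
        _ ≤ K * 4 ^ ε * 4 ^ α * δ ^ (-ε) * (((2 : ℝ) ^ (L + 1)) ^ β * δ ^ (-β)) := by gcongr
        _ = _ := by rw [neg_add, Real.rpow_add hδ0]; ring
    refine (mul_le_mul_of_nonneg_left (Finset.sum_le_sum hj) hc.le).trans (le_of_eq ?_)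
    rw [Finset.sum_const, Finset.card_range, nsmul_eq_mul]
    push_cast
    ring
  rw [Finset.sum_product]
  refine (Finset.sum_le_sum hterm).trans (le_of_eq ?_)
  rw [Finset.sum_const, nsmul_eq_mul]

/-! ### Covering numbers of projections -/

theorem lipschitzWith_starProjection {n m : ℕ} (V : Gr n m) : LipschitzWith 1 V.1.starProjection :=
  LipschitzWith.of_dist_le_mul fun x y => by
    rw [NNReal.coe_one, one_mul, dist_eq_norm, dist_eq_norm, ← map_sub]
    exact V.1.norm_starProjection_apply_le _

/-- Markov's inequality for the number of close pairs. -/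
theorem grMeasure_mul_card_le {n m : ℕ} (h : m ≤ n) (P : Finset (E n)) (hP : P.Nonempty)
    {δ t b : ℝ} (ht : 0 < t) (hb : ∑ p ∈ P ×ˢ P, (grMeasure h).real
      {V : Gr n m | dist (V.1.starProjection p.1) (V.1.starProjection p.2) ≤ δ} ≤ P.card * b) :
    grMeasure h {V : Gr n m | P.card * t ≤ (({p ∈ P ×ˢ P |
      dist (V.1.starProjection p.1) (V.1.starProjection p.2) ≤ δ} : Finset (E n × E n)).card : ℝ)} ≤
      ENNReal.ofReal (b / t) := by
  classical
  have hN : (0 : ℝ) < P.card := by exact_mod_cast hP.card_pos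
  let S : E n × E n → Set (Gr n m) := fun p =>
    {V | dist (V.1.starProjection p.1) (V.1.starProjection p.2) ≤ δ}
  have hS : ∀ p, MeasurableSet (S p) := fun p =>
    (isClosed_le ((continuous_starProjection_apply p.1).dist
      (continuous_starProjection_apply p.2)) continuous_const).measurableSet
  let f : Gr n m → ℝ := fun V => ∑ p ∈ P ×ˢ P, (S p).indicator 1 V
  have hf : ∀ V, f V = (({p ∈ P ×ˢ P |
      dist (V.1.starProjection p.1) (V.1.starProjection p.2) ≤ δ} : Finset (E n × E n)).card : ℝ) :=
    fun V => by
      rw [Finset.card_filter]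
      push_cast
      rfl
  have hfi : Integrable f (grMeasure h) :=
    integrable_finsetSum _ fun p _ => (integrable_const (1 : ℝ)).indicator (hS p)
  have hint : ∫ V, f V ∂(grMeasure h) = ∑ p ∈ P ×ˢ P, (grMeasure h).real (S p) := by
    refine (integral_finsetSum _ fun p _ => (integrable_const (1 : ℝ)).indicator (hS p)).trans ?_
    exact Finset.sum_congr rfl fun p _ => integral_indicator_one (hS p)
  have h1 := mul_meas_ge_le_integral_of_nonneg (μ := grMeasure h) (f := f)
    (ae_of_all _ fun V => by rw [hf]; positivity) hfi (P.card * t)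
  rw [hint] at h1
  have h2 : (P.card * t) * (grMeasure h).real {V | P.card * t ≤ f V} ≤ P.card * b := h1.trans hb
  simp only [← hf]
  rw [← ofReal_measureReal]
  refine ENNReal.ofReal_le_ofReal ?_
  rw [le_div_iff₀ ht]
  rw [mul_assoc] at h2
  linarith [le_of_mul_le_mul_left h2 hN]

theorem summable_scales (A : ℝ) (L : ℕ) {s : ℝ} (hs : 0 < s) :
    Summable fun k : ℕ => A * (k + L + 2) * ((1 / 2 : ℝ) ^ k) ^ s := by
  set q : ℝ := (1 / 2 : ℝ) ^ s with hq
  have hq0 : 0 ≤ q := by positivity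
  have hq1 : q < 1 := Real.rpow_lt_one (by norm_num) (by norm_num) hs
  have hqn : ‖q‖ < 1 := by rwa [Real.norm_of_nonneg hq0]
  have h1 : Summable fun k : ℕ => (k : ℝ) ^ 1 * q ^ k := 
    summable_pow_mul_geometric_of_norm_lt_one 1 hqn
  have h2 := (summable_geometric_of_norm_lt_one hqn).mul_left ((L : ℝ) + 2)
  refine ((h1.add h2).mul_left A).congr fun k => ?_
  have : ((1 / 2 : ℝ) ^ k) ^ s = q ^ k := by
    rw [hq, ← Real.rpow_natCast, ← Real.rpow_natCast, ← Real.rpow_mul (by norm_num),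
      ← Real.rpow_mul (by norm_num), mul_comm]
  rw [this]
  ring

theorem ae_eventually_coverNum_le_of_isSpectrumExponent {n m : ℕ} (h : m ≤ n) {F : Set (E n)}
    (hne : F.Nonempty) (hF : Bornology.IsBounded F) {θ α η : ℝ} (hθ0 : 0 < θ) (hθ1 : θ < 1)
    (hα : 0 ≤ α) (hs : IsSpectrumExponent θ F α) (hη : (1 - θ) * α + max 0 (α - m) < η) :
    ∀ᵐ V ∂(grMeasure h), ∀ᶠ r in 𝓝[>] (0 : ℝ),
      (coverNum r F : ℝ≥0∞) ≤ coverNum r (proj V F) * ENNReal.ofReal (r ^ (-η)) := by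
  classical
  have hη0 : 0 ≤ η := le_trans (add_nonneg (mul_nonneg (by linarith) hα) (le_max_left _ _)) hη.le
  have hFc : TotallyBounded F := hF.isCompact_closure.totallyBounded.subset subset_closure
  obtain ⟨A, hA, L, hsum⟩ := exists_sum_grMeasure_le h hF hθ0 hθ1 hα hs
  -- Separation 2^{-k}/4 makes |P k| bound the covering number at scale 2^{-k}/2, hence at every r
  -- in (2^{-k-1}, 2^{-k}].
  choose P hPF hP hcov using fun k : ℕ => exists_maximal_separated hFc
    (ρ := (1 / 2) ^ k / 4) (by positivity)
  have hPne : ∀ k, (P k).Nonempty := fun k => by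
    obtain ⟨x, hx⟩ := hne
    obtain ⟨y, hy, -⟩ := hcov k x hx
    exact ⟨y, hy⟩
  let Q : ℕ → Gr n m → ℕ := fun k V => ({p ∈ P k ×ˢ P k | dist (V.1.starProjection p.1)
    (V.1.starProjection p.2) ≤ (1 / 2) ^ k} : Finset (E n × E n)).card
  let bad : ℕ → Set (Gr n m) := fun k =>
    {V | (P k).card * ((1 / 2 : ℝ) ^ k) ^ (-η) ≤ (Q k V : ℝ)}
  obtain ⟨k₀, hk₀⟩ := eventually_atTop.1 hsum
  have hbad : ∀ k, grMeasure h (bad (k + k₀)) ≤ ENNReal.ofReal (A * ((k + k₀ : ℕ) + L + 2) *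
      ((1 / 2 : ℝ) ^ (k + k₀)) ^ (η - ((1 - θ) * α + max 0 (α - m)))) := fun k => by
    have h0 : (0 : ℝ) < (1 / 2) ^ (k + k₀) := by positivity
    refine (grMeasure_mul_card_le h (P (k + k₀)) (hPne _) (by positivity)
      (hk₀ (k + k₀) (by lia) (P (k + k₀)) (hPF _) (hP _))).trans (le_of_eq ?_)
    congr 1
    rw [mul_div_assoc, ← Real.rpow_sub h0]
    congr 2
    ring
  -- Borel–Cantelli: the strict slack in η gives geometric decay that absorbs the factor linear in
  -- k.
  have hfin : ∑' k, grMeasure h (bad (k + k₀)) ≠ ⊤ := by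
    have hsm := (summable_nat_add_iff k₀).2 (summable_scales A L (sub_pos.2 hη))
    refine ne_top_of_le_ne_top ?_ (ENNReal.tsum_le_tsum hbad)
    exact hsm.tsum_ofReal_ne_top
  filter_upwards [ae_eventually_notMem hfin] with V hV
  obtain ⟨k₁, hk₁⟩ := eventually_atTop.1 hV
  have hgood : ∀ k, k₀ + k₁ ≤ k → ((P k).card : ℝ≥0∞) ≤ coverNum ((1 / 2) ^ k) (proj V F) *
      ENNReal.ofReal (((1 / 2 : ℝ) ^ k) ^ (-η)) := by
    intro k hk
    have h1 := hk₁ (k - k₀) (by lia)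
    rw [Nat.sub_add_cancel (by lia)] at h1
    have h2 : (Q k V : ℝ) ≤ (P k).card * ((1 / 2 : ℝ) ^ k) ^ (-η) := (not_le.1 h1).le
    have h3 : (Q k V : ℝ≥0∞) ≤ (P k).card * ENNReal.ofReal (((1 / 2 : ℝ) ^ k) ^ (-η)) := by
      rw [← ENNReal.ofReal_natCast (Q k V), ← ENNReal.ofReal_natCast (P k).card,
        ← ENNReal.ofReal_mul (by positivity)]
      exact ENNReal.ofReal_le_ofReal h2
    have h4 := (sq_card_le_coverNum_mul (f := V.1.starProjection) (hPF k)
      (δ := (1 / 2) ^ k) (by positivity)).trans (mul_le_mul_right h3 _)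
    have h5 : ((P k).card : ℝ≥0∞) ≠ 0 := by exact_mod_cast (hPne k).card_pos.ne'
    rw [sq, mul_left_comm] at h4
    exact (ENNReal.mul_le_mul_iff_right h5 (ENNReal.natCast_ne_top _)).1 h4
  have hpos : (0 : ℝ) < (1 / 2) ^ (k₀ + k₁ + 1) := by positivity
  filter_upwards [Ioo_mem_nhdsGT hpos] with r ⟨hr0, hr1⟩
  obtain ⟨k, hk1, hk2⟩ := exists_nat_pow_near_of_lt_one hr0
    (hr1.le.trans (pow_le_one₀ (by norm_num) (by norm_num))) (by norm_num : (0 : ℝ) < 1 / 2)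
    (by norm_num)
  have hk : k₀ + k₁ ≤ k := by
    have := (pow_lt_pow_iff_right_of_lt_one₀ (by norm_num : (0 : ℝ) < 1 / 2) (by norm_num)).1
      (hk1.trans hr1)
    lia
  have h1 : coverNum r F ≤ (P k).card := by
    refine (coverNum_anti ?_ F).trans (coverNum_two_mul_le_card (hcov k))
    rw [pow_succ] at hk1
    linarith
  calc (coverNum r F : ℝ≥0∞) ≤ (P k).card := by exact_mod_cast h1
    _ ≤ coverNum ((1 / 2) ^ k) (proj V F) * ENNReal.ofReal (((1 / 2 : ℝ) ^ k) ^ (-η)) := hgood k hk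
    _ ≤ _ := by
      refine mul_le_mul' (by exact_mod_cast coverNum_anti hk2 _) (ENNReal.ofReal_le_ofReal ?_)
      exact Real.rpow_le_rpow_of_nonpos hr0 hk2 (neg_nonpos.2 hη0)

theorem IsSpectrumExponent.mono {X : Type*} [PseudoMetricSpace X] {F : Set X} {θ α α' : ℝ}
    (h : IsSpectrumExponent θ F α) (hα : α ≤ α') : IsSpectrumExponent θ F α' := by
  obtain ⟨C, hC, H⟩ := h
  refine ⟨C, hC, fun r R hr hrR hRR hR1 x hx => (H r R hr hrR hRR hR1 x hx).trans ?_⟩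
  refine ENNReal.ofReal_le_ofReal (mul_le_mul_of_nonneg_left ?_ hC.le)
  exact Real.rpow_le_rpow_of_exponent_le ((one_le_div hr).2 (hrR.trans hRR.le)) hα

/-- The spectrum increases to its limit, and admissible exponents are closed upwards. -/
theorem isSpectrumExponent_of_quasiAssouadDim_lt {X : Type*} [PseudoMetricSpace X] {F : Set X}
    {α θ : ℝ} (hα : quasiAssouadDim F < α) (hθ0 : 0 < θ) (hθ1 : θ < 1) :
    IsSpectrumExponent θ F α := by
  have h1 : upperAssouadSpectrum θ F ≤ quasiAssouadDim F := by
    refine ge_of_tendsto (tendsto_quasiAssouadDim F) ?_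
    filter_upwards [Ioo_mem_nhdsLT hθ1] with θ' hθ'
    exact upperAssouadSpectrum_mono F hθ0 hθ'.1.le hθ'.2
  obtain ⟨α', hα'⟩ := iInf_lt_iff.1 (h1.trans_lt hα)
  obtain ⟨hα1, hα2⟩ := iInf_lt_iff.1 hα'
  exact hα1.mono (by exact_mod_cast hα2.le)

theorem quasiAssouadDim_mono {X : Type*} [PseudoMetricSpace X] {A B : Set X} (h : A ⊆ B) :
    quasiAssouadDim A ≤ quasiAssouadDim B := by
  refine limsup_le_limsup (Eventually.of_forall fun θ => le_iInf₂ fun α hα => iInf₂_le α ?_)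
  obtain ⟨C, hC, H⟩ := hα
  refine ⟨C, hC, fun r R hr hrR hRR hR1 x hx => le_trans ?_ (H r R hr hrR hRR hR1 x (h hx))⟩
  exact_mod_cast coverNum_mono (inter_subset_inter_right _ h)

theorem ae_eventually_coverNum_le {n m : ℕ} (h : m ≤ n) {F : Set (E n)} (hne : F.Nonempty)
    (hF : Bornology.IsBounded F) {η : ℝ} (hη : max 0 (quasiAssouadDim F - m) < η) :
    ∀ᵐ V ∂(grMeasure h), ∀ᶠ r in 𝓝[>] (0 : ℝ),
      (coverNum r F : ℝ≥0∞) ≤ coverNum r (proj V F) * ENNReal.ofReal (r ^ (-η)) := by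
  obtain ⟨hη0, hη1⟩ := max_lt_iff.1 hη
  have hη0 : 0 < η := by exact_mod_cast hη0
  have hη2 : quasiAssouadDim F < ((η + m : ℝ) : EReal) := by
    rw [EReal.sub_lt_iff (Or.inl (EReal.natCast_ne_bot m)) (Or.inl (EReal.natCast_ne_top m))] at hη1
    exact_mod_cast hη1
  obtain ⟨α₀, hα₀, hα₁⟩ := EReal.lt_iff_exists_real_btwn.1 hη2
  have hα₁ : α₀ < η + m := by exact_mod_cast hα₁
  set α := max 0 α₀ with hα
  have hα0 : 0 ≤ α := le_max_left _ _
  have hαη : α < η + m := max_lt (by positivity) hα₁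
  have hqα : quasiAssouadDim F < α := hα₀.trans_le (by exact_mod_cast le_max_right _ _)
  -- The loss (1-θ)α vanishes as θ → 1.
  have hlim : ∀ᶠ θ in 𝓝[<] (1 : ℝ), (1 - θ) * α + max 0 (α - m) < η := by
    have hc : ContinuousAt (fun θ : ℝ => (1 - θ) * α + max 0 (α - m)) 1 := by fun_prop
    refine (hc.eventually_lt continuousAt_const ?_).filter_mono nhdsWithin_le_nhds
    rw [sub_self, zero_mul, zero_add]
    exact max_lt hη0 (by linarith)
  obtain ⟨θ, hθ, hθ0, hθ1⟩ := (hlim.and (Ioo_mem_nhdsLT (zero_lt_one' ℝ))).exists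
  exact ae_eventually_coverNum_le_of_isSpectrumExponent h hne hF hθ0 hθ1 hα0
    (isSpectrumExponent_of_quasiAssouadDim_lt hqα hθ0 hθ1) hθ

theorem sub_le_of_forall_rat {a b c : EReal} (hc : 0 ≤ c)
    (h : ∀ q : ℚ, c < ((q : ℝ) : EReal) → a ≤ b + ((q : ℝ) : EReal)) : a - c ≤ b := by
  induction c with
  | bot => simp at hc
  | top => simp
  | coe c =>
    rw [EReal.sub_le_iff_le_add (Or.inl (EReal.coe_ne_bot c)) (Or.inl (EReal.coe_ne_top c))]
    induction b with
    | bot =>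
      obtain ⟨q, hq⟩ := exists_rat_gt c
      simpa using h q (by exact_mod_cast hq)
    | top => simp
    | coe b =>
      refine EReal.le_of_forall_lt_iff_le.1 fun z hz => ?_
      have hz : b + c < z := by exact_mod_cast hz
      obtain ⟨q, hq1, hq2⟩ := exists_rat_btwn (lt_sub_iff_add_lt'.2 hz)
      refine (h q (by exact_mod_cast hq1)).trans ?_
      exact_mod_cast (lt_sub_iff_add_lt'.1 hq2).le

theorem ae_boxDim_proj_ge {n m : ℕ} (h : m ≤ n) {F : Set (E n)} (hne : F.Nonempty)
    (hF : Bornology.IsBounded F) : ∀ᵐ V ∂(grMeasure h),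
      upperBoxDim F - max 0 (quasiAssouadDim F - m) ≤ upperBoxDim (proj V F) ∧
      lowerBoxDim F - max 0 (quasiAssouadDim F - m) ≤ lowerBoxDim (proj V F) := by
  have : ∀ᵐ V ∂(grMeasure h), ∀ q : ℚ, max 0 (quasiAssouadDim F - m) < ((q : ℝ) : EReal) →
      ∀ᶠ r in 𝓝[>] (0 : ℝ),
      (coverNum r F : ℝ≥0∞) ≤ coverNum r (proj V F) * ENNReal.ofReal (r ^ (-(q : ℝ))) := by
    refine ae_all_iff.2 fun q => ?_
    by_cases hq : max 0 (quasiAssouadDim F - m) < ((q : ℝ) : EReal)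
    · filter_upwards [ae_eventually_coverNum_le h hne hF hq] with V hV _ using hV
    · exact ae_of_all _ fun V hq' => absurd hq' hq
  filter_upwards [this] with V hV
  exact ⟨sub_le_of_forall_rat (le_max_left _ _) fun q hq => upperBoxDim_le_add (hV q hq),
    sub_le_of_forall_rat (le_max_left _ _) fun q hq => lowerBoxDim_le_add (hV q hq)⟩

/-! ### Packing dimension -/

theorem coverNum_closure {X : Type*} [PseudoEMetricSpace X] (r : ℝ) (A : Set X) :
    coverNum r (closure A) = coverNum r A := by
  classical
  refine le_antisymm (le_iInf fun C => le_iInf₂ fun hA hC => ?_) (coverNum_mono subset_closure)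
  refine (coverNum_le_card (C.image closure) ?_ ?_).trans (by exact_mod_cast Finset.card_image_le)
  · refine closure_minimal (fun x hx => ?_) ?_
    · obtain ⟨U, hU, hxU⟩ := mem_iUnion₂.1 (hA hx)
      exact mem_iUnion₂.2 ⟨_, Finset.mem_image_of_mem _ hU, subset_closure hxU⟩
    · refine isClosed_biUnion_finset fun U hU => ?_
      obtain ⟨W, -, rfl⟩ := Finset.mem_image.1 hU
      exact isClosed_closure
  · intro U hU
    obtain ⟨W, hW, rfl⟩ := Finset.mem_image.1 hU
    rw [Metric.ediam_closure]
    exact hC W hW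

theorem upperBoxDim_empty {X : Type*} [PseudoEMetricSpace X] :
    upperBoxDim (∅ : Set X) = ⊥ := by
  refine le_bot_iff.1 (limsup_le_of_le (h := ?_))
  filter_upwards [Ioo_mem_nhdsGT (zero_lt_one' ℝ)] with r ⟨hr0, hr1⟩
  have h0 : coverNum r (∅ : Set X) = 0 :=
    le_antisymm (by simpa using coverNum_le_card (A := (∅ : Set X)) (r := r) ∅ (by simp) (by simp))
      zero_le
  have hl : 0 < -Real.log r := neg_pos.2 (Real.log_neg hr0 hr1)
  rw [boxRatio, h0, ENat.toENNReal_zero, ENNReal.log_zero,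
    EReal.bot_div_of_pos_ne_top (by exact_mod_cast hl) (EReal.coe_ne_top _)]

theorem packingDim_le_iSup {X : Type*} [PseudoEMetricSpace X] {A : Set X} (K : ℕ → Set X)
    (hK : ∀ j, IsCompact (K j)) (hA : A ⊆ ⋃ j, K j) : packingDim A ≤ ⨆ j, upperBoxDim (K j) :=
  iInf_le_of_le K (iInf₂_le_of_le hK hA le_rfl)

theorem packingDim_mono {X : Type*} [PseudoEMetricSpace X] {A B : Set X} (h : A ⊆ B) :
    packingDim A ≤ packingDim B :=
  le_iInf fun K => le_iInf₂ fun hK hB => packingDim_le_iSup K hK (h.trans hB)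

theorem packingDim_le_upperBoxDim {X : Type*} [PseudoMetricSpace X] [ProperSpace X] {A : Set X}
    (hA : Bornology.IsBounded A) : packingDim A ≤ upperBoxDim A := by
  refine (packingDim_le_iSup (fun _ => closure A) (fun _ => hA.isCompact_closure)
    (subset_closure.trans (subset_iUnion (fun _ : ℕ => closure A) 0))).trans ?_
  exact iSup_le fun _ => upperBoxDim_le_of_coverNum_le fun r => (coverNum_closure r A).le

theorem packingDim_iUnion_le {X : Type*} [PseudoEMetricSpace X] {A : ℕ → Set X} {t : EReal}
    (h : ∀ i, packingDim (A i) ≤ t) : packingDim (⋃ i, A i) ≤ t := by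
  refine le_of_forall_gt_imp_ge_of_dense fun c hc => ?_
  have h1 : ∀ i, ∃ K : ℕ → Set X, (∀ j, IsCompact (K j)) ∧ A i ⊆ ⋃ j, K j ∧
      ∀ j, upperBoxDim (K j) ≤ c := fun i => by
    obtain ⟨K, hK⟩ := iInf_lt_iff.1 ((h i).trans_lt hc)
    obtain ⟨hK1, hK⟩ := iInf_lt_iff.1 hK
    obtain ⟨hK2, hK⟩ := iInf_lt_iff.1 hK
    exact ⟨K, hK1, hK2, fun j => (le_iSup (fun j => upperBoxDim (K j)) j).trans hK.le⟩
  choose K hK hA hKc using h1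
  refine (packingDim_le_iSup (fun k => K k.unpair.1 k.unpair.2) (fun k => hK _ _) ?_).trans
    (iSup_le fun k => hKc _ _)
  refine iUnion_subset fun i x hx => ?_
  obtain ⟨j, hj⟩ := mem_iUnion.1 (hA i hx)
  exact mem_iUnion.2 ⟨Nat.pair i j, by simpa using hj⟩

theorem packingDim_biUnion_le {X ι : Type*} [PseudoEMetricSpace X] {A : ι → Set X} {s : Set ι}
    (hs : s.Countable) (hne : s.Nonempty) {t : EReal} (h : ∀ i ∈ s, packingDim (A i) ≤ t) :
    packingDim (⋃ i ∈ s, A i) ≤ t := by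
  obtain ⟨f, rfl⟩ := hs.exists_eq_range hne
  rw [biUnion_range]
  exact packingDim_iUnion_le fun i => h _ (mem_range_self i)

/-- An analytic set of packing dimension greater than `t` contains a continuous image of a nonempty
Polish space all of whose nonempty open subsets have images of packing dimension greater
than `t`. -/
theorem exists_polish_forall_lt_packingDim {X : Type*} [PseudoMetricSpace X] {F : Set X}
    (hF : AnalyticSet F) {t : EReal} (ht : t < packingDim F) :
    ∃ (Y : Type) (_ : TopologicalSpace Y) (φ : Y → X), PolishSpace Y ∧ Nonempty Y ∧
      Continuous φ ∧ range φ ⊆ F ∧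
      ∀ U : Set Y, IsOpen U → U.Nonempty → t < packingDim (φ '' U) := by
  obtain ⟨β, _, _, f, hf, hfF⟩ := analyticSet_iff_exists_polishSpace_range.1 hF
  let B := TopologicalSpace.countableBasis β
  have hB := TopologicalSpace.isBasis_countableBasis β
  let bad : Set (Set β) := {U | U ∈ B ∧ packingDim (f '' U) ≤ t}
  have hbadc : bad.Countable :=
    (TopologicalSpace.countable_countableBasis β).mono fun U hU => hU.1
  let Z : Set β := (⋃ U ∈ bad, U)ᶜ
  have hZ : IsClosed Z :=
    (isOpen_biUnion fun U (hU : U ∈ bad) => hB.isOpen hU.1).isClosed_compl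
  -- Outside Z, the image of b is covered by countably many images of packing dimension at most t,
  -- so only b ∩ Z matters.
  have key : ∀ b : Set β, packingDim (f '' (b ∩ Z)) ≤ t → packingDim (f '' b) ≤ t := by
    intro b hb
    have hsub : f '' b ⊆ ⋃ W ∈ insert (b ∩ Z) bad, f '' W := by
      rintro _ ⟨x, hx, rfl⟩
      rw [biUnion_insert]
      by_cases hxZ : x ∈ Z
      · exact Or.inl ⟨x, ⟨hx, hxZ⟩, rfl⟩
      · obtain ⟨U, hU, hxU⟩ := mem_iUnion₂.1 (not_not.1 hxZ)
        exact Or.inr (mem_iUnion₂.2 ⟨U, hU, x, hxU, rfl⟩)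
    refine (packingDim_mono hsub).trans
      (packingDim_biUnion_le (hbadc.insert _) (insert_nonempty _ _) fun W hW => ?_)
    rcases hW with rfl | hW
    · exact hb
    · exact hW.2
  refine ⟨Z, inferInstance, f ∘ Subtype.val, hZ.polishSpace, ?_, hf.comp continuous_subtype_val,
    ?_, ?_⟩
  · by_contra hne
    have hZe : Z = ∅ := eq_empty_of_forall_notMem fun x hx => hne ⟨x, hx⟩
    have h1 := key univ
    rw [hZe, inter_empty, image_empty, image_univ, hfF] at h1
    refine absurd (h1 ?_) (not_le.2 ht)
    refine (packingDim_le_iSup (fun _ => ∅) (fun _ => isCompact_empty) (empty_subset _)).trans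
      (iSup_le fun _ => upperBoxDim_empty.trans_le bot_le)
  · rintro _ ⟨y, rfl⟩
    exact hfF ▸ mem_range_self _
  · rintro _ ⟨U, hU, rfl⟩ ⟨y, hy⟩
    obtain ⟨b, hb, hyb, hbU⟩ := hB.exists_subset_of_mem_open hy hU
    by_contra hle
    have h1 : packingDim (f '' (b ∩ Z)) ≤ t := by
      refine (packingDim_mono ?_).trans (not_lt.1 hle)
      rintro _ ⟨x, ⟨hxb, hxZ⟩, rfl⟩
      exact ⟨⟨x, hxZ⟩, hbU hxb, rfl⟩
    exact y.2 (mem_iUnion₂.2 ⟨b, ⟨hb, key b h1⟩, hyb⟩)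

/-- The exceptional null set is fixed through a countable basis, before the compact cover, which may
depend on V, is given. Baire's theorem then finds a basic open set whose projected image lies in one
compact set. -/
theorem ae_packingDim_proj_ge_of_lt {n m : ℕ} (h : m ≤ n) {F : Set (E n)} (hF : MeasurableSet F)
    {t : EReal} (ht : t < packingDim F) : ∀ᵐ V ∂(grMeasure h),
      t - max 0 (quasiAssouadDim F - m) ≤ packingDim (proj V F) := by
  obtain ⟨Y, _, φ, _, _, hφ, hφF, hY⟩ :=
    exists_polish_forall_lt_packingDim hF.analyticSet ht
  let B := TopologicalSpace.countableBasis Y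
  have hB := TopologicalSpace.isBasis_countableBasis Y
  have hae : ∀ᵐ V ∂(grMeasure h), ∀ b ∈ B, b.Nonempty → Bornology.IsBounded (φ '' b) →
      upperBoxDim (φ '' b) - max 0 (quasiAssouadDim (φ '' b) - m) ≤
        upperBoxDim (proj V (φ '' b)) := by
    refine (ae_ball_iff (TopologicalSpace.countable_countableBasis Y)).2 fun b hb => ?_
    by_cases hb' : b.Nonempty ∧ Bornology.IsBounded (φ '' b)
    · filter_upwards [ae_boxDim_proj_ge h (hb'.1.image φ) hb'.2] with V hV _ _ using hV.1
    · exact ae_of_all _ fun V h1 h2 => absurd ⟨h1, h2⟩ hb'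
  filter_upwards [hae] with V hV
  refine le_iInf fun K => le_iInf₂ fun hK hcov => ?_
  have hcont : Continuous fun y => V.1.starProjection (φ y) :=
    V.1.starProjection.continuous.comp hφ
  have hVF : ∀ y, V.1.starProjection (φ y) ∈ proj V F :=
    fun y => mem_image_of_mem _ (hφF (mem_range_self y))
  have : BaireSpace Y := by
    have := TopologicalSpace.upgradeIsCompletelyMetrizable Y
    infer_instance
  obtain ⟨j, y, hy⟩ := nonempty_interior_of_iUnion_of_closed
    (f := fun j => (fun y => V.1.starProjection (φ y)) ⁻¹' K j)
    (fun j => (hK j).isClosed.preimage hcont)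
    (eq_univ_of_forall fun y => by simpa using hcov (hVF y))
  -- Intersecting with the preimage of a unit ball makes the image bounded, since F need not be.
  obtain ⟨b, hb, hyb, hbsub⟩ := hB.exists_subset_of_mem_open
    (u := interior ((fun y => V.1.starProjection (φ y)) ⁻¹' K j) ∩
      φ ⁻¹' Metric.ball (φ y) 1) ⟨hy, by simp⟩
    (isOpen_interior.inter (Metric.isOpen_ball.preimage hφ))
  have hbdd : Bornology.IsBounded (φ '' b) := Metric.isBounded_ball.subset
    (image_subset_iff.2 fun x hx => (hbsub hx).2)
  have h1 : t ≤ upperBoxDim (φ '' b) :=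
    (hY b (hB.isOpen hb) ⟨y, hyb⟩).le.trans (packingDim_le_upperBoxDim hbdd)
  have h2 : quasiAssouadDim (φ '' b) ≤ quasiAssouadDim F :=
    quasiAssouadDim_mono ((image_subset_range _ _).trans hφF)
  have h3 : proj V (φ '' b) ⊆ K j := by
    rintro _ ⟨_, ⟨x, hx, rfl⟩, rfl⟩
    have hx' : x ∈ (fun y => V.1.starProjection (φ y)) ⁻¹' K j := interior_subset (hbsub hx).1
    exact hx'
  calc t - max 0 (quasiAssouadDim F - m)
      ≤ upperBoxDim (φ '' b) - max 0 (quasiAssouadDim (φ '' b) - m) :=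
        EReal.sub_le_sub h1 (max_le_max le_rfl (EReal.sub_le_sub h2 le_rfl))
    _ ≤ upperBoxDim (proj V (φ '' b)) := hV b hb ⟨y, hyb⟩ hbdd
    _ ≤ upperBoxDim (K j) := upperBoxDim_mono h3
    _ ≤ ⨆ j, upperBoxDim (K j) := le_iSup (fun j => upperBoxDim (K j)) j

theorem sub_le_of_forall_rat_lt {a b c : EReal} (hc : 0 ≤ c)
    (h : ∀ q : ℚ, ((q : ℝ) : EReal) < a → ((q : ℝ) : EReal) - c ≤ b) : a - c ≤ b := by
  induction c with
  | bot => simp at hc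
  | top => simp
  | coe c =>
    rw [EReal.sub_le_iff_le_add (Or.inl (EReal.coe_ne_bot c)) (Or.inl (EReal.coe_ne_top c))]
    refine le_of_forall_lt_imp_le_of_dense fun z hz => ?_
    obtain ⟨q, hq1, hq2⟩ := EReal.lt_iff_exists_rat_btwn.1 hz
    refine hq1.le.trans ?_
    rw [← EReal.sub_le_iff_le_add (Or.inl (EReal.coe_ne_bot c)) (Or.inl (EReal.coe_ne_top c))]
    exact h q hq2

theorem ae_packingDim_proj_ge {n m : ℕ} (h : m ≤ n) {F : Set (E n)} (hF : MeasurableSet F) :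
    ∀ᵐ V ∂(grMeasure h),
      packingDim F - max 0 (quasiAssouadDim F - m) ≤ packingDim (proj V F) := by
  have : ∀ᵐ V ∂(grMeasure h), ∀ q : ℚ, ((q : ℝ) : EReal) < packingDim F →
      ((q : ℝ) : EReal) - max 0 (quasiAssouadDim F - m) ≤ packingDim (proj V F) := by
    refine ae_all_iff.2 fun q => ?_
    by_cases hq : ((q : ℝ) : EReal) < packingDim F
    · filter_upwards [ae_packingDim_proj_ge_of_lt h hF hq] with V hV _ using hV
    · exact ae_of_all _ fun V hq' => absurd hq' hq
  filter_upwards [this] with V hV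
  exact sub_le_of_forall_rat_lt (le_max_left _ _) hV

/-! ### Upper bounds, and the equality case -/

theorem packingDim_le_finrank {n : ℕ} (V : Submodule ℝ (E n)) {A : Set (E n)} (hAV : A ⊆ V) :
    packingDim A ≤ Module.finrank ℝ V := by
  refine (packingDim_le_iSup (fun j : ℕ => Metric.closedBall 0 j ∩ V) (fun j =>
    (isCompact_closedBall 0 _).inter_right V.closed_of_finiteDimensional) fun x hx => ?_).trans
    (iSup_le fun j => upperBoxDim_le_finrank V inter_subset_right
      (Metric.isBounded_closedBall.subset inter_subset_left))
  obtain ⟨j, hj⟩ := exists_nat_ge ‖x‖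
  exact mem_iUnion.2 ⟨j, by simpa using hj, hAV hx⟩

theorem proj_subset {n m : ℕ} (V : Gr n m) (F : Set (E n)) : proj V F ⊆ V.1 := by
  rintro _ ⟨x, -, rfl⟩
  exact V.1.starProjection_apply_mem x

theorem packingDim_proj_le {n m : ℕ} (V : Gr n m) (F : Set (E n)) :
    packingDim (proj V F) ≤ min (m : EReal) (packingDim F) := by
  refine le_min ((packingDim_le_finrank V.1 (proj_subset V F)).trans (by rw [V.2]))
    (le_iInf fun K => le_iInf₂ fun hK hF => ?_)
  refine (packingDim_le_iSup (fun j => proj V (K j))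
    (fun j => (hK j).image V.1.starProjection.continuous) ?_).trans
    (iSup_mono fun j => upperBoxDim_le_of_coverNum_le fun r =>
      coverNum_image_le (lipschitzWith_starProjection V) r _)
  exact (image_mono hF).trans (image_iUnion).subset

theorem isBounded_proj {n m : ℕ} (V : Gr n m) {F : Set (E n)} (hF : Bornology.IsBounded F) :
    Bornology.IsBounded (proj V F) :=
  (lipschitzWith_starProjection V).isBounded_image hF

theorem upperBoxDim_proj_le {n m : ℕ} (V : Gr n m) {F : Set (E n)} (hF : Bornology.IsBounded F) :
    upperBoxDim (proj V F) ≤ min (m : EReal) (upperBoxDim F) :=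
  le_min ((upperBoxDim_le_finrank V.1 (proj_subset V F) (isBounded_proj V hF)).trans (by rw [V.2]))
    (upperBoxDim_le_of_coverNum_le fun r =>
      coverNum_image_le (lipschitzWith_starProjection V) r _)

theorem lowerBoxDim_proj_le {n m : ℕ} (V : Gr n m) {F : Set (E n)} (hF : Bornology.IsBounded F) :
    lowerBoxDim (proj V F) ≤ min (m : EReal) (lowerBoxDim F) :=
  le_min ((lowerBoxDim_le_upperBoxDim _).trans ((upperBoxDim_proj_le V hF).trans (min_le_left _ _)))
    (lowerBoxDim_le_of_coverNum_le fun r =>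
      coverNum_image_le (lipschitzWith_starProjection V) r _)

theorem upperBoxDim_lt_top {n : ℕ} {F : Set (E n)} (hF : Bornology.IsBounded F) :
    upperBoxDim F < ⊤ :=
  (upperBoxDim_le_finrank ⊤ (subset_univ F) hF).trans_lt (EReal.natCast_ne_top _).lt_top

theorem packingDim_lt_top {n : ℕ} (F : Set (E n)) : packingDim F < ⊤ :=
  (packingDim_le_finrank ⊤ (subset_univ F)).trans_lt (EReal.natCast_ne_top _).lt_top

/-- If q ≤ m nothing is subtracted; otherwise q ≤ d, so d - (q - m) ≥ m. -/
theorem eq_min_of_sub_max_le {m : ℕ} {d q e : EReal} (hd : d < ⊤) (hq : q ≤ max (m : EReal) d)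
    (hle : e ≤ min (m : EReal) d) (hge : d - max 0 (q - m) ≤ e) : e = min (m : EReal) d := by
  refine le_antisymm hle (le_trans ?_ hge)
  rcases le_or_gt q m with hqm | hqm
  · have : q - m ≤ 0 := EReal.sub_nonpos.2 hqm
    rw [max_eq_left this, sub_zero]
    exact min_le_right _ _
  · have hqd : q ≤ d := (le_max_iff.1 hq).resolve_left (not_le.2 hqm)
    lift q to ℝ using ⟨(hqd.trans_lt hd).ne, (bot_le.trans_lt hqm).ne'⟩
    lift d to ℝ using ⟨hd.ne, ((EReal.bot_lt_coe q).trans_le hqd).ne'⟩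
    have hqd : q ≤ d := by exact_mod_cast hqd
    have hqm : (m : ℝ) < q := by exact_mod_cast hqm
    refine (min_le_left _ _).trans ?_
    have h1 : max (0 : EReal) ((q : EReal) - m) = ((q - m : ℝ) : EReal) := by
      rw [max_eq_right]
      · rfl
      · have : (0 : ℝ) ≤ q - m := by linarith
        exact_mod_cast this
    rw [h1, ← EReal.coe_sub]
    have : (m : ℝ) ≤ d - (q - m) := by linarith
    exact_mod_cast this

end ProjDim

end

theorem corollary1p3 (n m : ℕ) (hm : 1 ≤ m) (hmn : m < n)
    (F : Set (EuclideanSpace ℝ (Fin n))) (hF : F.Nonempty) :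
    -- box dimensions of bounded sets
    (Bornology.IsBounded F →
      -- upper box dimension
      (ProjDim.quasiAssouadDim F ≤ max (m : EReal) (ProjDim.upperBoxDim F) →
        ∀ᵐ V ∂(ProjDim.grMeasure hmn.le),
          ProjDim.upperBoxDim (ProjDim.proj V F) = min (m : EReal) (ProjDim.upperBoxDim F)) ∧
      (∀ᵐ V ∂(ProjDim.grMeasure hmn.le),
          ProjDim.upperBoxDim (ProjDim.proj V F) ≥
            ProjDim.upperBoxDim F - max 0 (ProjDim.quasiAssouadDim F - (m : EReal))) ∧
      -- lower box dimension
      (ProjDim.quasiAssouadDim F ≤ max (m : EReal) (ProjDim.lowerBoxDim F) →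
        ∀ᵐ V ∂(ProjDim.grMeasure hmn.le),
          ProjDim.lowerBoxDim (ProjDim.proj V F) = min (m : EReal) (ProjDim.lowerBoxDim F)) ∧
      (∀ᵐ V ∂(ProjDim.grMeasure hmn.le),
          ProjDim.lowerBoxDim (ProjDim.proj V F) ≥
            ProjDim.lowerBoxDim F - max 0 (ProjDim.quasiAssouadDim F - (m : EReal)))) ∧
    -- packing dimension of Borel sets, bounded or not
    (MeasurableSet F →
      (ProjDim.quasiAssouadDim F ≤ max (m : EReal) (ProjDim.packingDim F) →
        ∀ᵐ V ∂(ProjDim.grMeasure hmn.le),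
          ProjDim.packingDim (ProjDim.proj V F) = min (m : EReal) (ProjDim.packingDim F)) ∧
      (∀ᵐ V ∂(ProjDim.grMeasure hmn.le),
          ProjDim.packingDim (ProjDim.proj V F) ≥
            ProjDim.packingDim F - max 0 (ProjDim.quasiAssouadDim F - (m : EReal)))) := by
  refine ⟨fun hb => ?_, fun hmeas => ?_⟩
  · have hge := ProjDim.ae_boxDim_proj_ge hmn.le hF hb
    have hlt := ProjDim.upperBoxDim_lt_top hb
    refine ⟨fun hq => ?_, hge.mono fun V hV => hV.1, fun hq => ?_, hge.mono fun V hV => hV.2⟩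
    · filter_upwards [hge] with V hV
      exact ProjDim.eq_min_of_sub_max_le hlt hq (ProjDim.upperBoxDim_proj_le V hb) hV.1
    · filter_upwards [hge] with V hV
      exact ProjDim.eq_min_of_sub_max_le ((ProjDim.lowerBoxDim_le_upperBoxDim F).trans_lt hlt) hq
        (ProjDim.lowerBoxDim_proj_le V hb) hV.2
  · have hge := ProjDim.ae_packingDim_proj_ge hmn.le hmeas
    refine ⟨fun hq => ?_, hge⟩
    filter_upwards [hge] with V hV
    exact ProjDim.eq_min_of_sub_max_le (ProjDim.packingDim_lt_top F) hq
      (ProjDim.packingDim_proj_le V F) hV
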